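/- Let $\mathcal I$ be $\mathbb Q$ or $\mathbb Z$. Terms are variables and constants from $\mathcal I$. A condition is a finite conjunction of literals, each being a relational atom $p(s_1,\dots,s_n)$, a negated relational atom, or a comparison $s\mathrel\rho t$ with $\rho\in\{<,\le,>,\ge,=,\ne\}$. A condition is safe if every variable in it is limited, i.e. occurs in a positive relational atom or is equated with a constant or with a limited variable. For an aggregation function $\alpha$ mapping bags (finite multisets) of elements of $\mathcal I^k$ to values, a disjunctive $\alpha$-query with comparisons ranging over $\mathcal I$ has the form $q(\bar x,\alpha(\bar y))\leftarrow A_1\vee\dots\vee A_n$, where $\bar x$ is a tuple of variables (the grouping variables), $\bar y$ is a $k$-tuple of variables, and each $A_i$ is a safe condition containing all variables of $\bar x$ and $\bar y$. A database $\mathcal D$ is a finite set of ground relational atoms with constants from $\mathcal I$; its carrier is the set of constants occurring in it. For a tuple $\bar d$ over $\mathcal I$, let $B_{\bar d}$ be the bag which contains, for each $i\le n$ and each assignment $\gamma$ of elements of $\mathcal I$ to the variables of $A_i$ that satisfies $A_i$ over $\mathcal D$ and has $\gamma(\bar x)=\bar d$, one copy of $\gamma(\bar y)$ (an assignment satisfying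 several disjuncts is counted once for each). The result of $q$ over $\mathcal D$ is $$q^{\mathcal D}=\{(\bar d,\alpha(B_{\bar d})) : B_{\bar d}\neq\emptyset\}.$$ Two queries $q$ and $q'$ are $N$-equivalent if $q^{\mathcal D}=q'^{\mathcal D}$ for all databases $\mathcal D$ whose carrier has at most $N$ elements. The bounded equivalence problem for disjunctive $\alpha$-queries over $\mathcal I$ is to decide, given $N>0$ and two such queries $q$ and $q'$, whether they are $N$-equivalent. Theorem. Both for $\mathcal I=\mathbb Q$ and for $\mathcal I=\mathbb Z$, the bounded equivalence problem is decidable for the disjunctive $\alpha$-queries over $\mathcal I$, for each of the following aggregation functions $\alpha$: the functions $\mathrm{MAX}$ (greatest element), $\mathrm{SUM}$, $\mathrm{PROD}$ (product), $\mathrm{AVG}$ (average, a rational number) and $\mathrm{TOP2}$ (the pair of the two greatest different elements, with second component undefined if there is only one) on bags of elements of $\mathcal I$; and, for every $k\ge 0$, the functions $\mathrm{COUNT}$ (number of elements), $\mathrm{CNTD}$ (number of distinct elements) and $\mathrm{PRTY}$ (parity of the number of elements) on bags of elements of $\mathcal I^k$. -/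

import Mathlib

namespace AggQuery

/-! ### Syntax of disjunctive aggregate queries -/

/-- A term is a variable (named by a natural number) or a constant of the domain `I`. -/
inductive Term (I : Type) : Type where
  | var (v : ℕ) : Term I
  | const (c : I) : Term I

/-- The ordering predicates. -/
inductive CompOp : Type where
  | lt | le | gt | ge | eq | ne

/-- A relational atom `p(s₁, …, sₙ)`. A predicate is identified by its name and its arity, the
length of the argument list. -/
structure Atom (I : Type) : Type where
  pred : ℕ
  args : List (Term I)

/-- An ordering atom `s ρ t`. -/
structure Comparison (I : Type) : Type where
  lhs : Term I
  op : CompOp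
  rhs : Term I

/-- A literal: a positive relational atom, a negated relational atom, or a comparison. -/
inductive Literal (I : Type) : Type where
  | pos (a : Atom I) : Literal I
  | neg (a : Atom I) : Literal I
  | cmp (c : Comparison I) : Literal I

/-- A condition is a conjunction of literals. -/
abbrev Condition (I : Type) : Type := List (Literal I)

/-- The syntactic data of a disjunctive aggregate query
`q(x̄, α(ȳ)) ← A₁ ∨ … ∨ Aₙ` for an aggregation function `α` on `k`-tuples:
the grouping variables `x̄`, the aggregation variables `ȳ`, and the disjuncts. -/
structure RawQuery (I : Type) (k : ℕ) : Type where
  groupVars : List ℕ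
  aggVars : Fin k → ℕ
  disjuncts : List (Condition I)

/-- The variable that a term consists of, if any. -/
def Term.var? {I : Type} : Term I → Option ℕ
  | .var v => some v
  | .const _ => none

/-- The terms occurring in a literal. -/
def Literal.terms {I : Type} : Literal I → List (Term I)
  | .pos a => a.args
  | .neg a => a.args
  | .cmp c => [c.lhs, c.rhs]

/-- The variables occurring in a condition. -/
def Condition.vars {I : Type} (A : Condition I) : Finset ℕ :=
  ((A.flatMap Literal.terms).filterMap Term.var?).toFinset

/-- The condition `A` contains the equality `s = t` or `t = s`. -/
def Condition.Equates {I : Type} (A : Condition I) (s t : Term I) : Prop :=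
  Literal.cmp ⟨s, CompOp.eq, t⟩ ∈ A ∨ Literal.cmp ⟨t, CompOp.eq, s⟩ ∈ A

/-- A variable is limited in `A` if it occurs in a positive relational atom of `A`, or is equated
in `A` with a constant or with a limited variable. -/
inductive Condition.Limited {I : Type} (A : Condition I) : ℕ → Prop where
  | ofAtom {a : Atom I} {v : ℕ} (ha : Literal.pos a ∈ A) (hv : Term.var v ∈ a.args) :
      Condition.Limited A v
  | ofConst {v : ℕ} {c : I} (h : A.Equates (Term.var v) (Term.const c)) :
      Condition.Limited A v
  | ofVar {v w : ℕ} (h : A.Equates (Term.var v) (Term.var w)) (hw : Condition.Limited A w) :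
      Condition.Limited A v

/-- A condition is safe if all its variables are limited. -/
def Condition.Safe {I : Type} (A : Condition I) : Prop :=
  ∀ v ∈ A.vars, A.Limited v

/-- The data form a query: each disjunct is safe and contains all the grouping variables and all
the aggregation variables. -/
def RawQuery.IsQuery {I : Type} {k : ℕ} (q : RawQuery I k) : Prop :=
  ∀ A ∈ q.disjuncts, A.Safe ∧ (∀ v ∈ q.groupVars, v ∈ A.vars) ∧ ∀ i, q.aggVars i ∈ A.vars

/-! ### Semantics -/

/-- A ground relational atom over the domain `I`. -/
structure GroundAtom (I : Type) : Type where
  pred : ℕ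
  args : List I

/-- A database is a finite set of ground relational atoms. -/
abbrev Database (I : Type) : Type := Finset (GroundAtom I)

/-- The carrier of a database: the set of constants occurring in it. -/
def Database.carrier {I : Type} [DecidableEq I] (D : Database I) : Finset I :=
  Finset.biUnion D fun a => a.args.toFinset

/-- The value of a term under an assignment of domain elements to variables. -/
def Term.eval {I : Type} (γ : ℕ → I) : Term I → I
  | .var v => γ v
  | .const c => c

/-- The interpretation of the ordering predicates. -/
def CompOp.holds {I : Type} [LinearOrder I] : CompOp → I → I → Prop
  | .lt, a, b => a < b
  | .le, a, b => a ≤ b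
  | .gt, a, b => a > b
  | .ge, a, b => a ≥ b
  | .eq, a, b => a = b
  | .ne, a, b => a ≠ b

/-- The instance of a relational atom under an assignment. -/
def Atom.inst {I : Type} (γ : ℕ → I) (a : Atom I) : GroundAtom I :=
  ⟨a.pred, a.args.map (Term.eval γ)⟩

/-- Satisfaction of a literal by an assignment over a database. -/
def Literal.Holds {I : Type} [LinearOrder I] (D : Database I) (γ : ℕ → I) : Literal I → Prop
  | .pos a => a.inst γ ∈ D
  | .neg a => a.inst γ ∉ D
  | .cmp c => c.op.holds (c.lhs.eval γ) (c.rhs.eval γ)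

/-- The satisfying assignments of the condition `A` over the database `D`. An assignment for `A`
is a map from the variables of `A` to `I`; it is represented by the function on all variables that
takes the default value at each variable not occurring in `A`. -/
def Condition.satisfying {I : Type} [LinearOrder I] [Inhabited I] (A : Condition I)
    (D : Database I) : Set (ℕ → I) :=
  {γ | (∀ l ∈ A, l.Holds D γ) ∧ ∀ v, v ∉ A.vars → γ v = default}

/-- Under a satisfying assignment, a limited variable takes a value that occurs in the database or
in the condition. -/
theorem Condition.limited_value {I : Type} [LinearOrder I] {A : Condition I} {D : Database I}
    {γ : ℕ → I} (hγ : ∀ l ∈ A, l.Holds D γ) {v : ℕ} (hv : A.Limited v) :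
    γ v ∈ D.carrier ∨ Term.const (γ v) ∈ A.flatMap Literal.terms := by
  induction hv with
  | @ofAtom a v ha hv =>
    left
    have h := hγ _ ha
    refine Finset.mem_biUnion.2 ⟨_, h, ?_⟩
    simp only [Atom.inst, List.mem_toFinset, List.mem_map]
    exact ⟨_, hv, rfl⟩
  | @ofConst v c h =>
    right
    rcases h with h | h
    · have h1 : γ v = c := hγ _ h
      rw [h1]
      exact List.mem_flatMap.2 ⟨_, h, by simp [Literal.terms]⟩
    · have h1 : c = γ v := hγ _ h
      rw [← h1]
      exact List.mem_flatMap.2 ⟨_, h, by simp [Literal.terms]⟩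
  | @ofVar v w h _ ih =>
    have h1 : γ v = γ w := by
      rcases h with h | h
      · exact hγ _ h
      · exact (hγ _ h : γ w = γ v).symm
    rw [h1]
    exact ih

/-- A safe condition has only finitely many satisfying assignments over a database. -/
theorem Condition.Safe.finite_satisfying {I : Type} [LinearOrder I] [Inhabited I]
    {A : Condition I} (hA : A.Safe) (D : Database I) : (A.satisfying D).Finite := by
  classical
  let c? : Term I → Option I := fun t => match t with
    | .var _ => none
    | .const c => some c
  let F : Finset I := D.carrier ∪ ((A.flatMap Literal.terms).filterMap c?).toFinset
  have key : ∀ γ ∈ A.satisfying D, ∀ v ∈ A.vars, γ v ∈ F := by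
    intro γ hγ v hv
    rcases Condition.limited_value hγ.1 (hA v hv) with h | h
    · exact Finset.mem_union_left _ h
    · refine Finset.mem_union_right _ (List.mem_toFinset.2 (List.mem_filterMap.2 ⟨_, h, rfl⟩))
  let r : A.satisfying D → (A.vars → F) := fun γ v => ⟨γ.1 v, key γ.1 γ.2 v v.2⟩
  have hr : Function.Injective r := by
    intro γ γ' h
    apply Subtype.ext
    funext v
    by_cases hv : v ∈ A.vars
    · have := congrFun h ⟨v, hv⟩
      exact congrArg Subtype.val this
    · rw [γ.2.2 v hv, γ'.2.2 v hv]
  exact Set.finite_coe_iff.1 (Finite.of_injective r hr)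


open Classical in
/-- The satisfying assignments as a finite set. The set is finite for every safe condition; the
value for an unsafe condition is irrelevant. -/
noncomputable def Condition.satFinset {I : Type} [LinearOrder I] [Inhabited I] (A : Condition I)
    (D : Database I) : Finset (ℕ → I) :=
  if h : (A.satisfying D).Finite then h.toFinset else ∅

/-- The bag that the query `q` collects over the database `D` for the group `d`: each disjunct
contributes, for each of its satisfying assignments `γ` with `γ(x̄) = d`, one copy of the tuple
`γ(ȳ)`. -/
noncomputable def RawQuery.groupBag {I : Type} {k : ℕ} [LinearOrder I] [Inhabited I]
    (q : RawQuery I k) (D : Database I) (d : List I) : Multiset (Fin k → I) :=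
  (q.disjuncts.map fun A =>
    ((A.satFinset D).filter fun γ => q.groupVars.map γ = d).val.map
      fun γ i => γ (q.aggVars i)).sum

/-- The result of the `α`-query `q` over the database `D`: the set of all pairs `(d, α(B))`
where `d` is a group for which the bag `B` collected by the query is nonempty. -/
def RawQuery.result {I V : Type} {k : ℕ} [LinearOrder I] [Inhabited I]
    (α : Multiset (Fin k → I) → V) (q : RawQuery I k) (D : Database I) : Set (List I × V) :=
  {p | q.groupBag D p.1 ≠ 0 ∧ p.2 = α (q.groupBag D p.1)}

/-- `N`-equivalence of `α`-queries: equal results over all databases whose carrier has at most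
`N` elements. -/
def NEquivalent {I V : Type} {k : ℕ} [LinearOrder I] [Inhabited I]
    (α : Multiset (Fin k → I) → V) (N : ℕ) (q q' : RawQuery I k) : Prop :=
  ∀ D : Database I, D.carrier.card ≤ N → q.result α D = q'.result α D

/-! ### Effective encodings of the syntax -/

/-- A term is either a variable or a constant. -/
def Term.equivSum (I : Type) : Term I ≃ ℕ ⊕ I where
  toFun
    | .var v => .inl v
    | .const c => .inr c
  invFun
    | .inl v => .var v
    | .inr c => .const c
  left_inv t := by cases t <;> rfl
  right_inv t := by cases t <;> rfl

/-- There are six ordering predicates. -/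
def CompOp.equivFin : CompOp ≃ Fin 6 where
  toFun
    | .lt => 0
    | .le => 1
    | .gt => 2
    | .ge => 3
    | .eq => 4
    | .ne => 5
  invFun i := match i with
    | 0 => .lt
    | 1 => .le
    | 2 => .gt
    | 3 => .ge
    | 4 => .eq
    | 5 => .ne
  left_inv t := by cases t <;> rfl
  right_inv t := by fin_cases t <;> rfl

/-- An atom as a pair. -/
def Atom.equivProd (I : Type) : Atom I ≃ ℕ × List (Term I) where
  toFun a := (a.pred, a.args)
  invFun p := ⟨p.1, p.2⟩
  left_inv _ := rfl
  right_inv _ := rfl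

/-- A comparison as a triple. -/
def Comparison.equivProd (I : Type) : Comparison I ≃ Term I × CompOp × Term I where
  toFun c := (c.lhs, c.op, c.rhs)
  invFun p := ⟨p.1, p.2.1, p.2.2⟩
  left_inv _ := rfl
  right_inv _ := rfl

/-- The three kinds of literals. -/
def Literal.equivSum (I : Type) : Literal I ≃ Atom I ⊕ Atom I ⊕ Comparison I where
  toFun
    | .pos a => .inl a
    | .neg a => .inr (.inl a)
    | .cmp c => .inr (.inr c)
  invFun
    | .inl a => .pos a
    | .inr (.inl a) => .neg a
    | .inr (.inr c) => .cmp c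
  left_inv l := by cases l <;> rfl
  right_inv l := by rcases l with _ | _ | _ <;> rfl

/-- A query as a triple. -/
def RawQuery.equivProd (I : Type) (k : ℕ) :
    RawQuery I k ≃ List ℕ × (Fin k → ℕ) × List (Condition I) where
  toFun q := (q.groupVars, q.aggVars, q.disjuncts)
  invFun p := ⟨p.1, p.2.1, p.2.2⟩
  left_inv _ := rfl
  right_inv _ := rfl

instance instPrimcodableTerm {I : Type} [Primcodable I] : Primcodable (Term I) :=
  Primcodable.ofEquiv _ (Term.equivSum I)

instance instPrimcodableCompOp : Primcodable CompOp :=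
  Primcodable.ofEquiv _ CompOp.equivFin

instance instPrimcodableAtom {I : Type} [Primcodable I] : Primcodable (Atom I) :=
  Primcodable.ofEquiv _ (Atom.equivProd I)

instance instPrimcodableComparison {I : Type} [Primcodable I] : Primcodable (Comparison I) :=
  Primcodable.ofEquiv _ (Comparison.equivProd I)

instance instPrimcodableLiteral {I : Type} [Primcodable I] : Primcodable (Literal I) :=
  Primcodable.ofEquiv _ (Literal.equivSum I)

instance instPrimcodableRawQuery {I : Type} {k : ℕ} [Primcodable I] :
    Primcodable (RawQuery I k) :=
  Primcodable.ofEquiv _ (RawQuery.equivProd I k)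

/-- Pairs of an integer and a natural number that form a reduced fraction. -/
def IsReduced (p : ℤ × ℕ) : Prop := 0 < p.2 ∧ p.1.natAbs.Coprime p.2

instance instDecidablePredIsReduced : DecidablePred IsReduced := fun p =>
  inferInstanceAs (Decidable (0 < p.2 ∧ p.1.natAbs.Coprime p.2))

theorem primrec_natAbs : Primrec Int.natAbs := by
  have h : Primrec fun z : ℤ => (Encodable.encode z + 1) / 2 :=
    Primrec.nat_div.comp (Primrec.succ.comp Primrec.encode) (Primrec.const 2)
  refine h.of_eq fun z => ?_
  cases z with
  | ofNat n =>
    have : Encodable.encode (Int.ofNat n) = 2 * n := rfl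
    rw [this]; simp only [Int.natAbs]; omega
  | negSucc n =>
    have : Encodable.encode (Int.negSucc n) = 2 * n + 1 := rfl
    rw [this]; simp only [Int.natAbs]; omega

theorem primrecPred_isReduced : PrimrecPred IsReduced := by
  have hmod : PrimrecRel fun (d : ℕ) (p : ℕ × ℕ) =>
      (¬ (p.1 % d = 0) ∨ ¬ (p.2 % d = 0)) ∨ d = 1 := by
    refine PrimrecPred.or (PrimrecPred.or (PrimrecPred.not ?_) (PrimrecPred.not ?_)) ?_
    · exact Primrec.eq.comp (Primrec.nat_mod.comp (Primrec.fst.comp Primrec.snd) Primrec.fst)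
        (Primrec.const 0)
    · exact Primrec.eq.comp (Primrec.nat_mod.comp (Primrec.snd.comp Primrec.snd) Primrec.fst)
        (Primrec.const 0)
    · exact Primrec.eq.comp Primrec.fst (Primrec.const 1)
  have hall := hmod.forall_mem_list
  have h2 : PrimrecPred fun p : ℤ × ℕ => ∀ d < p.2 + 1,
      (¬ (p.1.natAbs % d = 0) ∨ ¬ (p.2 % d = 0)) ∨ d = 1 :=
    (hall.comp (Primrec.list_range.comp (Primrec.succ.comp Primrec.snd))
      (Primrec.pair (primrec_natAbs.comp Primrec.fst) Primrec.snd)).of_eq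
      fun p => by simp only [List.mem_range]
  have h3 : PrimrecPred fun p : ℤ × ℕ => 0 < p.2 :=
    Primrec.nat_lt.comp (Primrec.const 0) Primrec.snd
  refine (h3.and h2).of_eq fun p => and_congr_right fun hp => ?_
  constructor
  · intro h
    have hd := h (Nat.gcd p.1.natAbs p.2) (Nat.lt_succ_of_le (Nat.gcd_le_right _ hp))
    rcases hd with (hd | hd) | hd
    · exact absurd (Nat.mod_eq_zero_of_dvd (Nat.gcd_dvd_left _ _)) hd
    · exact absurd (Nat.mod_eq_zero_of_dvd (Nat.gcd_dvd_right _ _)) hd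
    · exact hd
  · intro h d _
    by_cases h1 : p.1.natAbs % d = 0
    · by_cases h2 : p.2 % d = 0
      · exact Or.inr (Nat.eq_one_of_dvd_coprimes h (Nat.dvd_of_mod_eq_zero h1)
          (Nat.dvd_of_mod_eq_zero h2))
      · exact Or.inl (Or.inr h2)
    · exact Or.inl (Or.inl h1)

/-- A rational number as a reduced fraction. -/
def ratEquivReduced : ℚ ≃ {p : ℤ × ℕ // IsReduced p} where
  toFun x := ⟨(x.num, x.den), x.den_pos, x.reduced⟩
  invFun p := ⟨p.1.1, p.1.2, Nat.pos_iff_ne_zero.1 p.2.1, p.2.2⟩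
  left_inv _ := rfl
  right_inv _ := rfl

/-- Rational numbers are encoded by numerator and denominator. -/
instance instPrimcodableRat : Primcodable ℚ :=
  letI := Primcodable.subtype primrecPred_isReduced
  Primcodable.ofEquiv _ ratEquivReduced

/-! ### The decision problem and the aggregation functions -/

/-- The bounded equivalence problem for disjunctive `α`-queries with comparisons ranging over `I`
is decidable: there is an algorithm which, given `N > 0` and two such queries `q` and `q'`,
decides whether `q` and `q'` are `N`-equivalent. -/
def BoundedEquivalenceDecidable {I V : Type} {k : ℕ} [LinearOrder I] [Inhabited I] [Primcodable I]
    (α : Multiset (Fin k → I) → V) : Prop :=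
  ∃ f : ℕ × RawQuery I k × RawQuery I k → Bool, Computable f ∧
    ∀ (N : ℕ) (q q' : RawQuery I k), 0 < N → q.IsQuery → q'.IsQuery →
      (f (N, q, q') = true ↔ NEquivalent α N q q')

/-- The number of elements of a bag. -/
def aggCount (I : Type) (k : ℕ) (B : Multiset (Fin k → I)) : ℕ := B.card

/-- The parity of the number of elements of a bag. -/
def aggPrty (I : Type) (k : ℕ) (B : Multiset (Fin k → I)) : ℕ := B.card % 2

/-- The number of distinct elements of a bag. -/
def aggCntd (I : Type) [DecidableEq I] (k : ℕ) (B : Multiset (Fin k → I)) : ℕ :=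
  B.toFinset.card

/-- The greatest element of a bag (`⊥` for the empty bag). -/
def aggMax (I : Type) [LinearOrder I] (B : Multiset (Fin 1 → I)) : WithBot I :=
  (B.map fun t => (t 0 : WithBot I)).sup

/-- The pair of the two greatest different elements of a bag (the second one is `⊥` if the bag does
not contain two different elements). -/
def aggTop2 (I : Type) [LinearOrder I] (B : Multiset (Fin 1 → I)) : WithBot I × WithBot I :=
  (aggMax I B, aggMax I (B.filter fun t => (t 0 : WithBot I) < aggMax I B))

/-- The sum of the elements of a bag. -/
def aggSum (I : Type) [AddCommMonoid I] (B : Multiset (Fin 1 → I)) : I :=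
  (B.map fun t => t 0).sum

/-- The product of the elements of a bag. -/
def aggProd (I : Type) [CommMonoid I] (B : Multiset (Fin 1 → I)) : I :=
  (B.map fun t => t 0).prod

/-- The average of the elements of a bag of rational numbers. -/
def aggAvgRat (B : Multiset (Fin 1 → ℚ)) : ℚ :=
  (B.map fun t => t 0).sum / B.card

/-- The average, a rational number, of the elements of a bag of integers. -/
def aggAvgInt (B : Multiset (Fin 1 → ℤ)) : ℚ :=
  (B.map fun t => (t 0 : ℚ)).sum / B.card

end AggQuery

/-! The point is that a counterexample to `N`-equivalence can be moved into a finite set `F` that is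
computable from `N` and the constants `C` of the two queries; what remains is a finite check.

Let a database `D` and a group `d` witness a difference, and let `T` be the carrier together with
`C`. A map `φ` that is strictly monotone on `T` and fixes `C` preserves every literal, so it carries
satisfying assignments over `D` bijectively to those over the image of `D`; the bag for `φ(d)` is
the image under `φ` of the bag for `d` (`Transports.groupBag_map`). Only the predicates of the
queries matter, and by safety only values in `T` occur. It is therefore enough to find such a `φ`
into `F` for which the two aggregate values still differ.

For COUNT, PRTY, CNTD, MAX and TOP2 every `φ` works, because strictly monotone maps reflect equality
of the values (`separates_of_strictMonoOn`). For SUM, AVG and PROD a badly chosen `φ` may create a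
coincidence, so each element that is moved gets a block of at least four candidates, the blocks
lying in the order of the elements. Elements are replaced one at a time. As a function of a single
replaced value, the aggregate is affine or a monomial `c * x ^ m`, and two such functions that agree
on four points agree everywhere. Hence an existing difference survives for some candidate in the
block (`separates_of_update`). Any choice from the blocks is strictly monotone, whichever candidates
are taken.

Finite sets with enough room are `intGrid` and `ratGrid`. Over the integers there may be no room
between constants, so a whole interval around the constants stays fixed and blocks are placed only
outside it. Over the rationals each cell between consecutive multiples of `1 / Δ`, for a common
denominator `Δ`, is subdivided finely enough to hold all blocks.

The check itself consists of quantifiers over computed lists and is primitive recursive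
(`primrecPred_agreeOver`). The aggregation function enters it only through the test whether two
values are equal. -/

namespace AggQuery

/-! ### Primitive recursive operations on lists -/

section PrimrecTools

variable {α β γ : Type*} [Primcodable α] [Primcodable β] [Primcodable γ]

theorem primrecPred_forall_mem {f : α → List β} {R : α → β → Prop} (hf : Primrec f)
    (hR : PrimrecRel R) : PrimrecPred fun a => ∀ b ∈ f a, R a b :=
  hR.swap.forall_mem_list.comp hf Primrec.id

theorem primrecPred_exists_mem {f : α → List β} {R : α → β → Prop} (hf : Primrec f)
    (hR : PrimrecRel R) : PrimrecPred fun a => ∃ b ∈ f a, R a b :=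
  hR.swap.exists_mem_list.comp hf Primrec.id

theorem primrecPred_imp {p q : α → Prop} (hp : PrimrecPred p) (hq : PrimrecPred q) :
    PrimrecPred fun a => p a → q a :=
  (hp.not.or hq).of_eq fun _ => imp_iff_not_or.symm

theorem primrecPred_iff {p q : α → Prop} (hp : PrimrecPred p) (hq : PrimrecPred q) :
    PrimrecPred fun a => (p a ↔ q a) :=
  ((primrecPred_imp hp hq).and (primrecPred_imp hq hp)).of_eq fun _ => iff_iff_implies_and_implies.symm

theorem primrec_mem : PrimrecRel fun (a : α) (l : List α) => a ∈ l :=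
  (primrecPred_exists_mem (Primrec.snd (α := α) (β := List α))
    (R := fun p b => p.1 = b)
    (Primrec.eq.comp (Primrec.fst.comp Primrec.fst) Primrec.snd)).of_eq fun p => by simp

theorem primrec_filter {f : α → List β} {R : α → β → Prop} [∀ a, DecidablePred (R a)]
    (hf : Primrec f) (hR : PrimrecRel R) : Primrec fun a => (f a).filter fun b => R a b := by
  have hg : Primrec₂ fun (a : α) (b : β) => if R a b then some b else none :=
    Primrec.ite hR (Primrec.option_some.comp Primrec.snd) (Primrec.const none)
  refine (Primrec.listFilterMap hf hg).of_eq fun a => ?_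
  rw [← List.filterMap_eq_filter]
  congr 1
  funext b
  by_cases h : R a b <;> simp [h, Option.guard]

/-- All lists of length `n` with entries in `l`. -/
def listsOfLength (l : List α) : ℕ → List (List α)
  | 0 => [[]]
  | n + 1 => l.flatMap fun a => (listsOfLength l n).map (a :: ·)

omit [Primcodable α] in
theorem mem_listsOfLength {l : List α} {n : ℕ} {w : List α} :
    w ∈ listsOfLength l n ↔ w.length = n ∧ ∀ a ∈ w, a ∈ l := by
  induction n generalizing w with
  | zero => simp +contextual [listsOfLength]
  | succ n ih =>
    cases w with
    | nil => simp [listsOfLength]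
    | cons a w => simp [listsOfLength, ih]; tauto

omit [Primcodable α] in
theorem nodup_listsOfLength {l : List α} (hl : l.Nodup) (n : ℕ) : (listsOfLength l n).Nodup := by
  induction n with
  | zero => simp [listsOfLength]
  | succ n ih =>
    refine List.nodup_flatMap.2 ⟨fun a _ => ih.map (List.cons_injective), ?_⟩
    refine hl.imp fun {a b} hab => ?_
    simp only [Function.onFun, List.disjoint_left, List.mem_map]
    rintro _ ⟨u, _, rfl⟩ ⟨v, _, h⟩
    exact hab (List.cons.inj h).1.symm

theorem primrec_listsOfLength : Primrec₂ (listsOfLength : List α → ℕ → List (List α)) := by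
  have hg : Primrec₂ fun (l : List α) (p : ℕ × List (List α)) =>
      l.flatMap fun a => p.2.map (a :: ·) := by
    refine Primrec.list_flatMap Primrec.fst ?_
    refine Primrec.list_map (Primrec.snd.comp (Primrec.snd.comp Primrec.fst)) ?_
    exact Primrec.list_cons.comp (Primrec.snd.comp Primrec.fst) Primrec.snd
  refine Primrec₂.of_eq (Primrec.nat_rec (Primrec.const [[]]) hg) fun l n => ?_
  induction n with
  | zero => rfl
  | succ n ih => simp only [listsOfLength, ← ih]

/-- All sublists of a list. -/
def allSublists : List α → List (List α)
  | [] => [[]]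
  | a :: l => allSublists l ++ (allSublists l).map (a :: ·)

omit [Primcodable α] in
theorem mem_allSublists {l w : List α} : w ∈ allSublists l ↔ w.Sublist l := by
  induction l generalizing w with
  | nil => simp [allSublists]
  | cons a l ih =>
    simp only [allSublists, List.mem_append, List.mem_map, ih, List.sublist_cons_iff]
    constructor
    · rintro (h | ⟨r, h, rfl⟩)
      · exact Or.inl h
      · exact Or.inr ⟨r, rfl, h⟩
    · rintro (h | ⟨r, rfl, h⟩)
      · exact Or.inl h
      · exact Or.inr ⟨r, h, rfl⟩

theorem primrec_allSublists : Primrec (allSublists : List α → List (List α)) := by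
  have hh : Primrec₂ fun (_ : List α) (p : α × List α × List (List α)) =>
      p.2.2 ++ p.2.2.map (p.1 :: ·) := by
    have h1 : Primrec fun q : List α × (α × List α × List (List α)) => q.2.2.2 :=
      Primrec.snd.comp (Primrec.snd.comp Primrec.snd)
    refine Primrec.list_append.comp h1 (Primrec.list_map h1 ?_)
    exact Primrec.list_cons.comp (Primrec.fst.comp (Primrec.snd.comp Primrec.fst)) Primrec.snd
  refine (Primrec.list_rec Primrec.id (Primrec.const [[]]) hh).of_eq fun l => ?_
  induction l with
  | nil => rfl
  | cons a l ih => simp only [id, allSublists] at ih ⊢; rw [ih]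

theorem primrec_dedup [DecidableEq α] : Primrec (List.dedup : List α → List α) := by
  have hh : Primrec₂ fun (_ : List α) (p : α × List α) =>
      if p.1 ∈ p.2 then p.2 else p.1 :: p.2 :=
    Primrec.ite (primrec_mem.comp (Primrec.fst.comp Primrec.snd) (Primrec.snd.comp Primrec.snd))
      (Primrec.snd.comp Primrec.snd)
      (Primrec.list_cons.comp (Primrec.fst.comp Primrec.snd) (Primrec.snd.comp Primrec.snd))
  refine (Primrec.list_foldr Primrec.id (Primrec.const []) hh).of_eq fun l => ?_
  induction l with
  | nil => rfl
  | cons a l ih =>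
    simp only [id, List.foldr_cons] at ih ⊢
    rw [ih]
    by_cases h : a ∈ l
    · simp [h]
    · simp [h]

theorem primrec_list_sum {M : Type*} [Primcodable M] [AddCommMonoid M]
    (h : Primrec₂ ((· + ·) : M → M → M)) : Primrec (List.sum : List M → M) :=
  (Primrec.list_foldr Primrec.id (Primrec.const 0)
    (h.comp (Primrec.fst.comp Primrec.snd) (Primrec.snd.comp Primrec.snd)).to₂).of_eq fun _ => rfl

theorem primrec_list_prod {M : Type*} [Primcodable M] [CommMonoid M]
    (h : Primrec₂ ((· * ·) : M → M → M)) : Primrec (List.prod : List M → M) :=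
  (Primrec.list_foldr Primrec.id (Primrec.const 1)
    (h.comp (Primrec.fst.comp Primrec.snd) (Primrec.snd.comp Primrec.snd)).to₂).of_eq fun _ => rfl

end PrimrecTools

/-! ### Primitive recursive arithmetic on integers and rational numbers -/

theorem primrec_int_toNat : Primrec Int.toNat := by
  have h : Primrec fun z : ℤ =>
      if Encodable.encode z % 2 = 0 then Encodable.encode z / 2 else 0 :=
    Primrec.ite (Primrec.eq.comp (Primrec.nat_mod.comp Primrec.encode (Primrec.const 2))
      (Primrec.const 0)) (Primrec.nat_div.comp Primrec.encode (Primrec.const 2)) (Primrec.const 0)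
  refine h.of_eq fun z => ?_
  cases z with
  | ofNat n =>
    have : Encodable.encode (Int.ofNat n) = 2 * n := rfl
    rw [this]; simp
  | negSucc n =>
    have : Encodable.encode (Int.negSucc n) = 2 * n + 1 := rfl
    rw [this, if_neg (by omega)]; rfl

/-- The integers `n` and `-(n + 1)` have the codes `2 * n` and `2 * n + 1`, so the code of the
difference is a natural number expression. The other integer operations are then written as a
difference of natural numbers, using positive and negative parts, or are built from earlier ones. -/
theorem primrec_natCast_sub : Primrec₂ fun a b : ℕ => (a : ℤ) - b := by
  have h : Primrec₂ fun a b : ℕ => if b ≤ a then 2 * (a - b) else 2 * (b - a) - 1 := by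
    refine Primrec.ite (Primrec.nat_le.comp Primrec.snd Primrec.fst) ?_ ?_
    · exact Primrec.nat_mul.comp (Primrec.const 2) (Primrec.nat_sub.comp Primrec.fst Primrec.snd)
    · exact Primrec.nat_sub.comp (Primrec.nat_mul.comp (Primrec.const 2)
        (Primrec.nat_sub.comp Primrec.snd Primrec.fst)) (Primrec.const 1)
  refine Primrec₂.encode_iff.1 (h.of_eq fun a b => ?_)
  split_ifs with hab
  · obtain ⟨c, rfl⟩ := Nat.exists_eq_add_of_le hab
    have : ((b + c : ℕ) : ℤ) - b = Int.ofNat c := by simp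
    rw [this, show Encodable.encode (Int.ofNat c) = 2 * c from rfl]
    omega
  · obtain ⟨c, rfl⟩ := Nat.exists_eq_add_of_lt (not_le.1 hab)
    have : (a : ℤ) - (a + c + 1 : ℕ) = Int.negSucc c := by
      rw [Int.negSucc_eq]; push_cast; ring
    rw [this, show Encodable.encode (Int.negSucc c) = 2 * c + 1 from rfl]
    omega

theorem primrec_int_neg : Primrec (Neg.neg : ℤ → ℤ) := by
  have h : Primrec fun z : ℤ => ((z.natAbs - z.toNat : ℕ) : ℤ) - (z.toNat : ℕ) :=
    primrec_natCast_sub.comp (Primrec.nat_sub.comp primrec_natAbs primrec_int_toNat)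
      primrec_int_toNat
  exact h.of_eq fun z => by omega

theorem primrec_int_add : Primrec₂ ((· + ·) : ℤ → ℤ → ℤ) := by
  have h : Primrec₂ fun a b : ℤ =>
      ((a.toNat + b.toNat : ℕ) : ℤ) - ((-a).toNat + (-b).toNat : ℕ) := by
    refine primrec_natCast_sub.comp (Primrec.nat_add.comp ?_ ?_) (Primrec.nat_add.comp ?_ ?_)
    · exact primrec_int_toNat.comp Primrec.fst
    · exact primrec_int_toNat.comp Primrec.snd
    · exact primrec_int_toNat.comp (primrec_int_neg.comp Primrec.fst)
    · exact primrec_int_toNat.comp (primrec_int_neg.comp Primrec.snd)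
  exact h.of_eq fun a b => by omega

theorem primrec_natCast_int : Primrec (Nat.cast : ℕ → ℤ) :=
  (primrec_natCast_sub.comp Primrec.id (Primrec.const 0)).of_eq fun a => by simp

theorem primrec_int_lt : PrimrecRel ((· < ·) : ℤ → ℤ → Prop) := by
  have h : PrimrecRel fun a b : ℤ => 0 < (b + -a).toNat :=
    Primrec.nat_lt.comp (Primrec.const 0) (primrec_int_toNat.comp
      (primrec_int_add.comp Primrec.snd (primrec_int_neg.comp Primrec.fst)))
  exact h.of_eq fun a b => by omega

theorem primrec_int_mul : Primrec₂ ((· * ·) : ℤ → ℤ → ℤ) := by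
  have h : Primrec₂ fun a b : ℤ =>
      if (a < 0 ↔ b < 0) then ((a.natAbs * b.natAbs : ℕ) : ℤ)
        else -((a.natAbs * b.natAbs : ℕ) : ℤ) := by
    have hm : Primrec fun p : ℤ × ℤ => ((p.1.natAbs * p.2.natAbs : ℕ) : ℤ) :=
      primrec_natCast_int.comp (Primrec.nat_mul.comp (primrec_natAbs.comp Primrec.fst)
        (primrec_natAbs.comp Primrec.snd))
    exact Primrec.ite (primrecPred_iff (primrec_int_lt.comp Primrec.fst (Primrec.const 0))
      (primrec_int_lt.comp Primrec.snd (Primrec.const 0))) hm (primrec_int_neg.comp hm)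
  refine h.of_eq fun a b => ?_
  push_cast
  rcases lt_or_ge a 0 with ha | ha <;> rcases lt_or_ge b 0 with hb | hb
  · simp [ha, hb, abs_of_neg]
  · simp [ha, hb.not_gt, abs_of_neg, abs_of_nonneg hb]
  · simp [hb, ha.not_gt, abs_of_neg, abs_of_nonneg ha]
  · simp [hb.not_gt, ha.not_gt, abs_of_nonneg hb, abs_of_nonneg ha]

/-- Bounded search for the greatest common divisor. The bound `a + b` also covers the cases in which
one argument is zero; if both are, the search over `0` alone returns `0`. -/
theorem primrec_nat_gcd : Primrec₂ Nat.gcd := by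
  have hp : PrimrecRel fun (p : ℕ × ℕ) (d : ℕ) => p.1 % d = 0 ∧ p.2 % d = 0 :=
    PrimrecPred.and
      (Primrec.eq.comp (Primrec.nat_mod.comp (Primrec.fst.comp Primrec.fst) Primrec.snd)
        (Primrec.const 0))
      (Primrec.eq.comp (Primrec.nat_mod.comp (Primrec.snd.comp Primrec.fst) Primrec.snd)
        (Primrec.const 0))
  have h := Primrec.nat_findGreatest (f := fun p : ℕ × ℕ => p.1 + p.2)
    (Primrec.nat_add.comp Primrec.fst Primrec.snd) hp
  refine h.of_eq fun ⟨a, b⟩ => ?_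
  simp only [← Nat.dvd_iff_mod_eq_zero]
  rcases Nat.eq_zero_or_pos (a + b) with h0 | h0
  · obtain ⟨rfl, rfl⟩ : a = 0 ∧ b = 0 := by omega
    simp
  · refine le_antisymm ?_ ?_
    · refine Nat.le_of_dvd (Nat.gcd_pos_iff.2 (by omega)) (Nat.dvd_gcd ?_ ?_)
      · exact (Nat.findGreatest_spec (P := fun d => d ∣ a ∧ d ∣ b) (m := 1) (n := a + b)
          (by omega) (by simp)).1
      · exact (Nat.findGreatest_spec (P := fun d => d ∣ a ∧ d ∣ b) (m := 1) (n := a + b)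
          (by omega) (by simp)).2
    · refine Nat.le_findGreatest ?_ ⟨Nat.gcd_dvd_left _ _, Nat.gcd_dvd_right _ _⟩
      rcases Nat.eq_zero_or_pos a with rfl | ha
      · simp
      · exact (Nat.gcd_le_left _ ha).trans (Nat.le_add_right _ _)

/-! ### Rational arithmetic through numerators and denominators. -/

theorem primrec_rat_num : Primrec Rat.num := by
  let _ := Primcodable.subtype primrecPred_isReduced
  exact Primrec.fst.comp (Primrec.subtype_val.comp (Primrec.of_equiv (e := ratEquivReduced)))

theorem primrec_rat_den : Primrec Rat.den := by
  let _ := Primcodable.subtype primrecPred_isReduced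
  exact Primrec.snd.comp (Primrec.subtype_val.comp (Primrec.of_equiv (e := ratEquivReduced)))

theorem primrec_of_num_den {α : Type*} [Primcodable α] {f : α → ℚ}
    (hn : Primrec fun a => (f a).num) (hd : Primrec fun a => (f a).den) : Primrec f := by
  let _ := Primcodable.subtype primrecPred_isReduced
  refine (Primrec.of_equiv_iff ratEquivReduced).1 ?_
  refine (Primrec.subtype_val_iff (p := IsReduced)).1 ?_
  exact Primrec.pair hn hd

/-- Dividing by the gcd gives the reduced fraction that encodes the quotient; division by zero
yields `0`, that is, `0 / 1`. The arithmetic of rational numbers reduces to this and to integer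
arithmetic. -/
theorem primrec_divNat : Primrec₂ fun (a : ℤ) (b : ℕ) => (a : ℚ) / b := by
  have hg : Primrec fun p : ℤ × ℕ => p.1.natAbs.gcd p.2 :=
    primrec_nat_gcd.comp (primrec_natAbs.comp Primrec.fst) Primrec.snd
  have hs : Primrec fun p : ℤ × ℕ => if p.1 < 0 then -((p.1.natAbs / p.1.natAbs.gcd p.2 : ℕ) : ℤ)
      else ((p.1.natAbs / p.1.natAbs.gcd p.2 : ℕ) : ℤ) := by
    have hm : Primrec fun p : ℤ × ℕ => ((p.1.natAbs / p.1.natAbs.gcd p.2 : ℕ) : ℤ) :=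
      primrec_natCast_int.comp (Primrec.nat_div.comp (primrec_natAbs.comp Primrec.fst) hg)
    exact Primrec.ite (primrec_int_lt.comp Primrec.fst (Primrec.const 0))
      (primrec_int_neg.comp hm) hm
  have hb : PrimrecPred fun p : ℤ × ℕ => p.2 = 0 := Primrec.eq.comp Primrec.snd (Primrec.const 0)
  have e (p : ℤ × ℕ) (h : p.2 ≠ 0) : (p.1 : ℚ) / p.2 = Rat.normalize p.1 p.2 h := by
    rw [Rat.normalize_eq_mkRat, Rat.mkRat_eq_div]
  refine primrec_of_num_den ((Primrec.ite hb (Primrec.const 0) hs).of_eq fun p => ?_)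
    ((Primrec.ite hb (Primrec.const 1) (Primrec.nat_div.comp Primrec.snd hg)).of_eq fun p => ?_)
  · split_ifs with h h'
    · simp [h]
    · simp only [e p h, Rat.normalize_eq]
      obtain ⟨n, hn⟩ := Int.eq_ofNat_of_zero_le (show 0 ≤ -p.1 by omega)
      have h1 : p.1 = -(n : ℤ) := by omega
      have hdvd := Nat.gcd_dvd_left n p.2
      rw [h1, Int.natAbs_neg, Int.natAbs_natCast,
        Int.neg_ediv_of_dvd (by exact_mod_cast hdvd)]
      simp
    · simp only [e p h, Rat.normalize_eq]
      obtain ⟨n, hn⟩ := Int.eq_ofNat_of_zero_le (show 0 ≤ p.1 by omega)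
      rw [hn, Int.natAbs_natCast]
      simp
  · split_ifs with h
    · simp [h]
    · simp only [e p h, Rat.normalize_eq]

theorem primrec_rat_add : Primrec₂ ((· + ·) : ℚ → ℚ → ℚ) := by
  have n1 : Primrec fun p : ℚ × ℚ => p.1.num := primrec_rat_num.comp Primrec.fst
  have n2 : Primrec fun p : ℚ × ℚ => p.2.num := primrec_rat_num.comp Primrec.snd
  have d1 : Primrec fun p : ℚ × ℚ => p.1.den := primrec_rat_den.comp Primrec.fst
  have d2 : Primrec fun p : ℚ × ℚ => p.2.den := primrec_rat_den.comp Primrec.snd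
  refine (primrec_divNat.comp (primrec_int_add.comp
    (primrec_int_mul.comp n1 (primrec_natCast_int.comp d2))
    (primrec_int_mul.comp n2 (primrec_natCast_int.comp d1)))
    (Primrec.nat_mul.comp d1 d2)).of_eq fun ⟨a, b⟩ => ?_
  have ha : (a.den : ℚ) ≠ 0 := by exact_mod_cast a.den_ne_zero
  have hb : (b.den : ℚ) ≠ 0 := by exact_mod_cast b.den_ne_zero
  conv_rhs => rw [← Rat.num_div_den a, ← Rat.num_div_den b]
  push_cast
  field_simp

theorem primrec_rat_mul : Primrec₂ ((· * ·) : ℚ → ℚ → ℚ) := by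
  have n1 : Primrec fun p : ℚ × ℚ => p.1.num := primrec_rat_num.comp Primrec.fst
  have n2 : Primrec fun p : ℚ × ℚ => p.2.num := primrec_rat_num.comp Primrec.snd
  have d1 : Primrec fun p : ℚ × ℚ => p.1.den := primrec_rat_den.comp Primrec.fst
  have d2 : Primrec fun p : ℚ × ℚ => p.2.den := primrec_rat_den.comp Primrec.snd
  refine (primrec_divNat.comp (primrec_int_mul.comp n1 n2)
    (Primrec.nat_mul.comp d1 d2)).of_eq fun ⟨a, b⟩ => ?_
  conv_rhs => rw [← Rat.num_div_den a, ← Rat.num_div_den b]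
  push_cast
  rw [div_mul_div_comm]

theorem primrec_rat_lt : PrimrecRel ((· < ·) : ℚ → ℚ → Prop) := by
  have n1 : Primrec fun p : ℚ × ℚ => p.1.num := primrec_rat_num.comp Primrec.fst
  have n2 : Primrec fun p : ℚ × ℚ => p.2.num := primrec_rat_num.comp Primrec.snd
  have d1 : Primrec fun p : ℚ × ℚ => p.1.den := primrec_rat_den.comp Primrec.fst
  have d2 : Primrec fun p : ℚ × ℚ => p.2.den := primrec_rat_den.comp Primrec.snd
  exact (primrec_int_lt.comp (primrec_int_mul.comp n1 (primrec_natCast_int.comp d2))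
    (primrec_int_mul.comp n2 (primrec_natCast_int.comp d1))).of_eq fun p => (Rat.lt_iff p.1 p.2).symm


/-! ### Evaluation of queries over databases given as lists -/

section Evaluation

variable {I : Type} {k : ℕ}

/-- The database consisting of the listed atoms. -/
noncomputable def listDatabase (D : List (ℕ × List I)) : Database I :=
  open Classical in (D.map fun p => (⟨p.1, p.2⟩ : GroundAtom I)).toFinset

theorem mem_listDatabase {D : List (ℕ × List I)} {a : GroundAtom I} :
    a ∈ listDatabase D ↔ (a.pred, a.args) ∈ D := by
  classical
  simp only [listDatabase, List.mem_toFinset, List.mem_map, Prod.exists]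
  constructor
  · rintro ⟨p, w, h, rfl⟩
    exact h
  · exact fun h => ⟨_, _, h, rfl⟩

/-- The assignment that a list of values describes. -/
def valuation [Inhabited I] (w : List I) (v : ℕ) : I := w.getD v default

/-- The constant that a term consists of, if any. -/
def Term.const? : Term I → Option I
  | .var _ => none
  | .const c => some c

/-- The predicate name and arity of a relational literal. -/
def Literal.signature? : Literal I → Option (ℕ × ℕ)
  | .pos a => some (a.pred, a.args.length)
  | .neg a => some (a.pred, a.args.length)
  | .cmp _ => none

/-- The terms of a query. -/
def RawQuery.terms (q : RawQuery I k) : List (Term I) :=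
  q.disjuncts.flatten.flatMap Literal.terms

/-- The constants of a query. -/
def RawQuery.consts (q : RawQuery I k) : List I := q.terms.filterMap Term.const?

/-- The predicates of a query, with their arities. -/
def RawQuery.signature (q : RawQuery I k) : List (ℕ × ℕ) :=
  q.disjuncts.flatten.filterMap Literal.signature?

/-- A strict bound for the variables of a query. -/
def RawQuery.varBound (q : RawQuery I k) : ℕ := (q.terms.filterMap Term.var?).sum + 1

open Classical in
/-- The satisfying assignments of a condition with values in a list, given by lists of length
`m`. -/
noncomputable def satList [LinearOrder I] [Inhabited I] (F : List I) (m : ℕ)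
    (D : List (ℕ × List I)) (A : Condition I) : List (List I) :=
  (listsOfLength F m).filter fun w =>
    (∀ l ∈ A, l.Holds (listDatabase D) (valuation w)) ∧
      ∀ v ∈ List.range m, Term.var v ∉ A.flatMap Literal.terms → valuation w v = default

open Classical in
/-- The bag collected by a query for a group, as a list. -/
noncomputable def bagList [LinearOrder I] [Inhabited I] (F : List I) (m : ℕ)
    (D : List (ℕ × List I)) (q : RawQuery I k) (d : List I) : List (Fin k → I) :=
  q.disjuncts.flatMap fun A =>
    ((satList F m D A).filter fun w => q.groupVars.map (valuation w) = d).map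
      fun w i => valuation w (q.aggVars i)

/-- All databases over the given predicates with a carrier of at most `N` elements of a list. -/
def databaseLists (F : List I) (N : ℕ) (S : List (ℕ × ℕ)) : List (List (ℕ × List I)) :=
  (listsOfLength F N).flatMap fun W =>
    allSublists (S.flatMap fun p => (listsOfLength W p.2).map fun w => (p.1, w))

/-- The results of two queries agree on all databases over their predicates with a carrier of at
most `N` elements of the list `F`. -/
def AgreeOver {V : Type} [LinearOrder I] [Inhabited I] (α : Multiset (Fin k → I) → V)
    (F : List I) (N : ℕ) (q q' : RawQuery I k) : Prop :=
  ∀ D ∈ databaseLists F N (q.signature ++ q'.signature),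
    ∀ d ∈ listsOfLength F q.groupVars.length ++ listsOfLength F q'.groupVars.length,
      (bagList F (q.varBound + q'.varBound) D q d = [] ↔
        bagList F (q.varBound + q'.varBound) D q' d = []) ∧
      (bagList F (q.varBound + q'.varBound) D q d ≠ [] →
        α (bagList F (q.varBound + q'.varBound) D q d) =
          α (bagList F (q.varBound + q'.varBound) D q' d))

end Evaluation

/-! ### Evaluation is primitive recursive -/

section PrimrecEvaluation

variable {I : Type} {k : ℕ} [Primcodable I] {β : Type*} [Primcodable β]

theorem primrecPred_sum_elim {γ δ : Type*} [Primcodable γ] [Primcodable δ] {f : β → γ ⊕ δ}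
    {P : β → γ → Prop} {Q : β → δ → Prop} (hf : Primrec f) (hP : PrimrecRel P)
    (hQ : PrimrecRel Q) : PrimrecPred fun b => Sum.elim (P b) (Q b) (f b) := by
  classical
  refine Primrec.primrecPred ((Primrec.sumCasesOn hf hP.decide hQ.decide).of_eq fun b => ?_)
  cases f b <;> rfl

theorem primrec_var? : Primrec (Term.var? : Term I → Option ℕ) := by
  refine (Primrec.sumCasesOn (Primrec.of_equiv (e := Term.equivSum I))
    (g := fun _ v => some v) (h := fun _ _ => none)
    (Primrec.option_some.comp Primrec.snd) (Primrec.const none)).of_eq fun t => ?_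
  cases t <;> rfl

theorem primrec_const? : Primrec (Term.const? : Term I → Option I) := by
  refine (Primrec.sumCasesOn (Primrec.of_equiv (e := Term.equivSum I))
    (g := fun _ _ => none) (h := fun _ c => some c)
    (Primrec.const none) (Primrec.option_some.comp Primrec.snd)).of_eq fun t => ?_
  cases t <;> rfl

theorem primrec_term_var : Primrec (Term.var : ℕ → Term I) :=
  (Primrec.of_equiv_symm (e := Term.equivSum I)).comp Primrec.sumInl

theorem primrec_atom_pred : Primrec (Atom.pred : Atom I → ℕ) :=
  Primrec.fst.comp (Primrec.of_equiv (e := Atom.equivProd I))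

theorem primrec_atom_args : Primrec (Atom.args : Atom I → List (Term I)) :=
  Primrec.snd.comp (Primrec.of_equiv (e := Atom.equivProd I))

theorem primrec_comparison_lhs : Primrec (Comparison.lhs : Comparison I → Term I) :=
  Primrec.fst.comp (Primrec.of_equiv (e := Comparison.equivProd I))

theorem primrec_comparison_op : Primrec (Comparison.op : Comparison I → CompOp) :=
  Primrec.fst.comp (Primrec.snd.comp (Primrec.of_equiv (e := Comparison.equivProd I)))

theorem primrec_comparison_rhs : Primrec (Comparison.rhs : Comparison I → Term I) :=
  Primrec.snd.comp (Primrec.snd.comp (Primrec.of_equiv (e := Comparison.equivProd I)))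

theorem primrec_literal_terms : Primrec (Literal.terms : Literal I → List (Term I)) := by
  have h2 : Primrec₂ fun (_ : Literal I) (s : Atom I ⊕ Comparison I) =>
      Sum.elim Atom.args (fun c => [c.lhs, c.rhs]) s := by
    refine (Primrec.sumCasesOn (Primrec.snd (α := Literal I) (β := Atom I ⊕ Comparison I))
      (g := fun _ (a : Atom I) => a.args) (h := fun _ (c : Comparison I) => [c.lhs, c.rhs])
      (primrec_atom_args.comp Primrec.snd) ?_).of_eq fun p => by cases p.2 <;> rfl
    exact Primrec.list_cons.comp (primrec_comparison_lhs.comp Primrec.snd)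
      (Primrec.list_cons.comp (primrec_comparison_rhs.comp Primrec.snd) (Primrec.const []))
  refine (Primrec.sumCasesOn (Primrec.of_equiv (e := Literal.equivSum I))
    (g := fun _ (a : Atom I) => a.args) (primrec_atom_args.comp Primrec.snd) h2).of_eq fun l => ?_
  cases l <;> rfl

theorem primrec_literal_signature? :
    Primrec (Literal.signature? : Literal I → Option (ℕ × ℕ)) := by
  have ha : Primrec fun a : Atom I => some (a.pred, a.args.length) :=
    Primrec.option_some.comp (Primrec.pair primrec_atom_pred
      (Primrec.list_length.comp primrec_atom_args))
  have h2 : Primrec₂ fun (_ : Literal I) (s : Atom I ⊕ Comparison I) =>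
      Sum.elim (fun a => some (a.pred, a.args.length)) (fun _ => none) s := by
    exact (Primrec.sumCasesOn (Primrec.snd (α := Literal I) (β := Atom I ⊕ Comparison I))
      (g := fun _ (a : Atom I) => some (a.pred, a.args.length)) (h := fun _ _ => none)
      (ha.comp Primrec.snd) (Primrec.const none)).of_eq fun p => by cases p.2 <;> rfl
  refine (Primrec.sumCasesOn (Primrec.of_equiv (e := Literal.equivSum I))
    (g := fun _ (a : Atom I) => some (a.pred, a.args.length)) (ha.comp Primrec.snd) h2).of_eq fun l => ?_
  cases l <;> rfl

theorem primrec_groupVars : Primrec (RawQuery.groupVars : RawQuery I k → List ℕ) :=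
  Primrec.fst.comp (Primrec.of_equiv (e := RawQuery.equivProd I k))

theorem primrec_aggVars : Primrec (RawQuery.aggVars : RawQuery I k → Fin k → ℕ) :=
  Primrec.fst.comp (Primrec.snd.comp (Primrec.of_equiv (e := RawQuery.equivProd I k)))

theorem primrec_disjuncts : Primrec (RawQuery.disjuncts : RawQuery I k → List (Condition I)) :=
  Primrec.snd.comp (Primrec.snd.comp (Primrec.of_equiv (e := RawQuery.equivProd I k)))

theorem primrec_condition_terms :
    Primrec fun A : Condition I => A.flatMap Literal.terms :=
  Primrec.list_flatMap Primrec.id (primrec_literal_terms.comp Primrec.snd)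

theorem primrec_terms : Primrec (RawQuery.terms : RawQuery I k → List (Term I)) :=
  primrec_condition_terms.comp (Primrec.list_flatten.comp primrec_disjuncts)

theorem primrec_consts : Primrec (RawQuery.consts : RawQuery I k → List I) :=
  Primrec.listFilterMap primrec_terms (primrec_const?.comp Primrec.snd)

theorem primrec_signature : Primrec (RawQuery.signature : RawQuery I k → List (ℕ × ℕ)) :=
  Primrec.listFilterMap (Primrec.list_flatten.comp primrec_disjuncts)
    (primrec_literal_signature?.comp Primrec.snd)

theorem primrec_varBound : Primrec (RawQuery.varBound : RawQuery I k → ℕ) :=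
  Primrec.succ.comp ((primrec_list_sum Primrec.nat_add).comp
    (Primrec.listFilterMap primrec_terms (primrec_var?.comp Primrec.snd)))

theorem primrec_databaseLists {F : β → List I} {N : β → ℕ} {S : β → List (ℕ × ℕ)}
    (hF : Primrec F) (hN : Primrec N) (hS : Primrec S) :
    Primrec fun b => databaseLists (F b) (N b) (S b) := by
  refine Primrec.list_flatMap (primrec_listsOfLength.comp hF hN) ?_
  refine primrec_allSublists.comp ?_
  refine Primrec.list_flatMap (hS.comp Primrec.fst) ?_
  refine Primrec.list_map (primrec_listsOfLength.comp (Primrec.snd.comp Primrec.fst)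
    (Primrec.snd.comp Primrec.snd)) ?_
  exact Primrec.pair (Primrec.fst.comp (Primrec.snd.comp Primrec.fst)) Primrec.snd

section

variable [Inhabited I]

theorem primrec_valuation : Primrec₂ (valuation : List I → ℕ → I) :=
  Primrec.list_getD default

theorem primrec_term_eval : Primrec₂ fun (w : List I) (t : Term I) => t.eval (valuation w) := by
  refine (Primrec.sumCasesOn (f := fun p : List I × Term I => Term.equivSum I p.2)
    ((Primrec.of_equiv (e := Term.equivSum I)).comp Primrec.snd)
    (g := fun p v => valuation p.1 v) (h := fun _ c => c)
    (primrec_valuation.comp (Primrec.fst.comp Primrec.fst) Primrec.snd)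
    Primrec.snd).of_eq fun p => ?_
  rcases p with ⟨w, _ | _⟩ <;> rfl

end

/-- The case distinction over six operators is a finite disjunction of equality tests, and each
comparison is a Boolean combination of `<` and `=`. -/
theorem primrecPred_holds [LinearOrder I]
    (hlt : PrimrecRel ((· < ·) : I → I → Prop)) {o : β → CompOp}
    {s t : β → I} (ho : Primrec o) (hs : Primrec s) (ht : Primrec t) :
    PrimrecPred fun b => (o b).holds (s b) (t b) := by
  have h (c : CompOp) : PrimrecPred fun b => o b = c := Primrec.eq.comp ho (Primrec.const c)
  have h1 := hlt.comp hs ht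
  have h2 := hlt.comp ht hs
  have h3 : PrimrecPred fun b => s b = t b := Primrec.eq.comp hs ht
  refine (((h .lt).and h1).or (((h .le).and h2.not).or (((h .gt).and h2).or
    (((h .ge).and h1.not).or (((h .eq).and h3).or ((h .ne).and h3.not)))))).of_eq fun b => ?_
  cases o b <;> simp [CompOp.holds]

variable [LinearOrder I] [Inhabited I]

theorem primrecPred_literal_holds (hlt : PrimrecRel ((· < ·) : I → I → Prop))
    {D : β → List (ℕ × List I)} {w : β → List I} {l : β → Literal I} (hD : Primrec D)
    (hw : Primrec w) (hl : Primrec l) :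
    PrimrecPred fun b => (l b).Holds (listDatabase (D b)) (valuation (w b)) := by
  have ha : PrimrecRel fun (b : β) (a : Atom I) =>
      (a.pred, a.args.map (Term.eval (valuation (w b)))) ∈ D b := by
    refine primrec_mem.comp (Primrec.pair (primrec_atom_pred.comp Primrec.snd)
      (Primrec.list_map (primrec_atom_args.comp Primrec.snd) ?_)) (hD.comp Primrec.fst)
    exact primrec_term_eval.comp (hw.comp (Primrec.fst.comp Primrec.fst)) Primrec.snd
  have hc : PrimrecRel fun (b : β) (c : Comparison I) =>
      c.op.holds (c.lhs.eval (valuation (w b))) (c.rhs.eval (valuation (w b))) := by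
    refine primrecPred_holds hlt (primrec_comparison_op.comp Primrec.snd) ?_ ?_
    · exact primrec_term_eval.comp (hw.comp Primrec.fst) (primrec_comparison_lhs.comp Primrec.snd)
    · exact primrec_term_eval.comp (hw.comp Primrec.fst) (primrec_comparison_rhs.comp Primrec.snd)
  have h2 : PrimrecRel fun (b : β) (s : Atom I ⊕ Comparison I) =>
      Sum.elim (fun a : Atom I => ¬ (a.pred, a.args.map (Term.eval (valuation (w b)))) ∈ D b)
        (fun c : Comparison I =>
          c.op.holds (c.lhs.eval (valuation (w b))) (c.rhs.eval (valuation (w b)))) s :=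
    primrecPred_sum_elim (β := β × (Atom I ⊕ Comparison I)) Primrec.snd
      (P := fun p (a : Atom I) => ¬ (a.pred, a.args.map (Term.eval (valuation (w p.1)))) ∈ D p.1)
      (Q := fun p (c : Comparison I) =>
        c.op.holds (c.lhs.eval (valuation (w p.1))) (c.rhs.eval (valuation (w p.1))))
      (ha.not.comp (Primrec.fst.comp Primrec.fst) Primrec.snd)
      (hc.comp (Primrec.fst.comp Primrec.fst) Primrec.snd)
  refine (primrecPred_sum_elim ((Primrec.of_equiv (e := Literal.equivSum I)).comp hl)
    ha h2).of_eq fun b => ?_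
  cases l b with
  | pos a => exact (mem_listDatabase (a := a.inst (valuation (w b)))).symm
  | neg a => exact (not_congr (mem_listDatabase (a := a.inst (valuation (w b))))).symm
  | cmp c => exact Iff.rfl

theorem primrec_satList (hlt : PrimrecRel ((· < ·) : I → I → Prop)) {F : β → List I} {m : β → ℕ}
    {D : β → List (ℕ × List I)} {A : β → Condition I} (hF : Primrec F) (hm : Primrec m)
    (hD : Primrec D) (hA : Primrec A) :
    Primrec fun b => satList (F b) (m b) (D b) (A b) := by
  classical
  refine primrec_filter (primrec_listsOfLength.comp hF hm) (R := fun b w =>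
    (∀ l ∈ A b, l.Holds (listDatabase (D b)) (valuation w)) ∧
      ∀ v ∈ List.range (m b), Term.var v ∉ (A b).flatMap Literal.terms → valuation w v = default)
    (PrimrecPred.and ?_ ?_)
  · exact primrecPred_forall_mem (hA.comp Primrec.fst)
      (R := fun (p : β × List I) l => l.Holds (listDatabase (D p.1)) (valuation p.2))
      (primrecPred_literal_holds hlt (hD.comp (Primrec.fst.comp Primrec.fst))
        (Primrec.snd.comp Primrec.fst) Primrec.snd).primrecRel
  · refine primrecPred_forall_mem (Primrec.list_range.comp (hm.comp Primrec.fst))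
      (R := fun (p : β × List I) v =>
        Term.var v ∉ (A p.1).flatMap Literal.terms → valuation p.2 v = default)
      (primrecPred_imp ?_ ?_)
    · exact (primrec_mem.comp (primrec_term_var.comp Primrec.snd)
        (primrec_condition_terms.comp (hA.comp (Primrec.fst.comp Primrec.fst)))).not
    · exact Primrec.eq.comp (primrec_valuation.comp (Primrec.snd.comp Primrec.fst) Primrec.snd)
        (Primrec.const default)

theorem primrec_bagList (hlt : PrimrecRel ((· < ·) : I → I → Prop)) {F : β → List I} {m : β → ℕ}
    {D : β → List (ℕ × List I)} {q : β → RawQuery I k} {d : β → List I} (hF : Primrec F)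
    (hm : Primrec m) (hD : Primrec D) (hq : Primrec q) (hd : Primrec d) :
    Primrec fun b => bagList (F b) (m b) (D b) (q b) (d b) := by
  refine Primrec.list_flatMap (primrec_disjuncts.comp hq) ?_
  refine Primrec.list_map (β := List I) (primrec_filter
    (f := fun p : β × Condition I => satList (F p.1) (m p.1) (D p.1) p.2)
    (R := fun p (w : List I) => (q p.1).groupVars.map (valuation w) = d p.1)
    (primrec_satList hlt (hF.comp Primrec.fst) (hm.comp Primrec.fst) (hD.comp Primrec.fst)
      Primrec.snd) ?_) ?_
  · refine Primrec.eq.comp (Primrec.list_map (primrec_groupVars.comp (hq.comp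
      (Primrec.fst.comp Primrec.fst))) ?_) (hd.comp (Primrec.fst.comp Primrec.fst))
    exact primrec_valuation.comp (Primrec.snd.comp Primrec.fst) Primrec.snd
  · refine Primrec.fin_curry.2 (primrec_valuation.comp (Primrec.snd.comp Primrec.fst) ?_)
    exact Primrec.fin_app.comp (primrec_aggVars.comp (hq.comp
      (Primrec.fst.comp (Primrec.fst.comp Primrec.fst)))) Primrec.snd

/-- All quantifiers range over computed lists. The hypothesis on `α` concerns equality of values
only, so `V` needs no encoding. -/
theorem primrecPred_agreeOver {V : Type} (hlt : PrimrecRel ((· < ·) : I → I → Prop))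
    {α : Multiset (Fin k → I) → V}
    (hα : PrimrecRel fun l l' : List (Fin k → I) => α l = α l')
    {F : β → List I} {N : β → ℕ} {q q' : β → RawQuery I k} (hF : Primrec F)
    (hN : Primrec N) (hq : Primrec q) (hq' : Primrec q') :
    PrimrecPred fun b => AgreeOver α (F b) (N b) (q b) (q' b) := by
  have hm : Primrec fun b => (q b).varBound + (q' b).varBound :=
    Primrec.nat_add.comp (primrec_varBound.comp hq) (primrec_varBound.comp hq')
  have h1 : Primrec fun p : (β × List (ℕ × List I)) × List I => p.1.1 :=
    Primrec.fst.comp Primrec.fst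
  have h2 : Primrec fun p : (β × List (ℕ × List I)) × List I => p.1.2 :=
    Primrec.snd.comp Primrec.fst
  have hb := primrec_bagList hlt (hF.comp h1) (hm.comp h1) h2 (hq.comp h1) Primrec.snd
  have hb' := primrec_bagList hlt (hF.comp h1) (hm.comp h1) h2 (hq'.comp h1) Primrec.snd
  have hg : Primrec fun p : β × List (ℕ × List I) =>
      listsOfLength (F p.1) (q p.1).groupVars.length ++
        listsOfLength (F p.1) (q' p.1).groupVars.length :=
    (Primrec.list_append.comp
      (primrec_listsOfLength.comp hF (Primrec.list_length.comp (primrec_groupVars.comp hq)))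
      (primrec_listsOfLength.comp hF (Primrec.list_length.comp (primrec_groupVars.comp hq')))).comp
      Primrec.fst
  have e1 := Primrec.eq.comp hb (Primrec.const [])
  have e2 := Primrec.eq.comp hb' (Primrec.const [])
  have hd := primrec_databaseLists hF hN
    (Primrec.list_append.comp (primrec_signature.comp hq) (primrec_signature.comp hq'))
  have h := (primrecPred_iff e1 e2).and (primrecPred_imp e1.not (hα.comp hb hb'))
  refine (primrecPred_forall_mem hd (primrecPred_forall_mem hg h.primrecRel).primrecRel).of_eq fun b => Iff.rfl

end PrimrecEvaluation


/-! ### Correctness of the evaluation over lists -/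

section EvaluationCorrect

variable {I : Type} {k : ℕ}

theorem Condition.mem_vars {A : Condition I} {v : ℕ} :
    v ∈ A.vars ↔ Term.var v ∈ A.flatMap Literal.terms := by
  simp only [Condition.vars, List.mem_toFinset, List.mem_filterMap]
  constructor
  · rintro ⟨t, ht, h⟩
    cases t with
    | var u => cases h; exact ht
    | const c => cases h
  · exact fun h => ⟨_, h, rfl⟩

theorem RawQuery.mem_terms {q : RawQuery I k} {A : Condition I} (hA : A ∈ q.disjuncts)
    {t : Term I} (ht : t ∈ A.flatMap Literal.terms) : t ∈ q.terms := by
  obtain ⟨l, hl, ht⟩ := List.mem_flatMap.1 ht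
  exact List.mem_flatMap.2 ⟨l, List.mem_flatten.2 ⟨A, hA, hl⟩, ht⟩

theorem RawQuery.mem_consts {q : RawQuery I k} {A : Condition I} (hA : A ∈ q.disjuncts)
    {c : I} (hc : Term.const c ∈ A.flatMap Literal.terms) : c ∈ q.consts :=
  List.mem_filterMap.2 ⟨_, q.mem_terms hA hc, rfl⟩

theorem RawQuery.lt_varBound {q : RawQuery I k} {A : Condition I} (hA : A ∈ q.disjuncts)
    {v : ℕ} (hv : v ∈ A.vars) : v < q.varBound :=
  Nat.lt_succ_of_le (List.single_le_sum (fun _ _ => Nat.zero_le _) _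
    (List.mem_filterMap.2 ⟨_, q.mem_terms hA (Condition.mem_vars.1 hv), rfl⟩))

theorem RawQuery.mem_signature {q : RawQuery I k} {A : Condition I} (hA : A ∈ q.disjuncts)
    {l : Literal I} (hl : l ∈ A) {p : ℕ × ℕ} (hp : l.signature? = some p) : p ∈ q.signature :=
  List.mem_filterMap.2 ⟨l, List.mem_flatten.2 ⟨A, hA, hl⟩, hp⟩

theorem valuation_injOn [Inhabited I] (m : ℕ) :
    Set.InjOn (valuation (I := I)) {w | w.length = m} := by
  intro w hw w' hw' h
  refine List.ext_getElem (hw.trans hw'.symm) fun i h1 h2 => ?_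
  simpa [valuation, h1, h2] using congrFun h i

variable [LinearOrder I] [Inhabited I]

theorem Condition.mem_satFinset {A : Condition I} (hA : A.Safe) {D : Database I} {γ : ℕ → I} :
    γ ∈ A.satFinset D ↔ γ ∈ A.satisfying D := by
  rw [Condition.satFinset, dif_pos (hA.finite_satisfying D), Set.Finite.mem_toFinset]

/-- By safety all relevant values lie in the carrier or among the constants, hence in `F`. As `F`
has no duplicates and lists of equal length are determined by their valuations, each assignment is
enumerated exactly once, which keeps the multiplicities in the bags correct. -/
theorem satFinset_val_eq {A : Condition I} (hA : A.Safe) {F : List I} (hF : F.Nodup)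
    (h0 : default ∈ F) {m : ℕ} (hm : ∀ v ∈ A.vars, v < m)
    (hC : ∀ c, Term.const c ∈ A.flatMap Literal.terms → c ∈ F) {D : List (ℕ × List I)}
    (hD : ∀ c ∈ (listDatabase D).carrier, c ∈ F) :
    (A.satFinset (listDatabase D)).val = ((satList F m D A).map valuation : List (ℕ → I)) := by
  classical
  have hlen : ∀ w ∈ satList F m D A, w.length = m := fun w hw =>
    (mem_listsOfLength.1 (List.mem_filter.1 hw).1).1
  have hnd : ((satList F m D A).map valuation).Nodup :=
    List.Nodup.map_on (fun w hw w' hw' h => valuation_injOn m (hlen w hw) (hlen w' hw') h)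
      ((nodup_listsOfLength hF m).filter _)
  refine (Multiset.Nodup.ext (Finset.nodup _) (Multiset.coe_nodup.2 hnd)).2 fun γ => ?_
  rw [Finset.mem_val, Condition.mem_satFinset hA, Multiset.mem_coe, List.mem_map]
  constructor
  · rintro ⟨h1, h2⟩
    -- The first `m` values determine `γ`, because it takes the default value from `m` on.
    have e : valuation ((List.range m).map γ) = γ := by
      funext v
      by_cases hv : v < m
      · simp [valuation, hv]
      · simp [valuation, hv, h2 v fun h => hv (hm v h)]
    refine ⟨(List.range m).map γ, List.mem_filter.2 ⟨mem_listsOfLength.2 ⟨by simp, ?_⟩, ?_⟩, e⟩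
    · simp only [List.mem_map, List.mem_range]
      rintro _ ⟨v, _, rfl⟩
      by_cases hv : v ∈ A.vars
      · rcases Condition.limited_value h1 (hA v hv) with h | h
        · exact hD _ h
        · exact hC _ h
      -- Variables below `m` that do not occur in `A` carry the default value; this is why `F` must
      -- contain it.
      · rw [h2 v hv]
        exact h0
    · rw [decide_eq_true_iff, e]
      exact ⟨h1, fun v _ hv => h2 v fun h => hv (Condition.mem_vars.1 h)⟩
  · rintro ⟨w, hw, rfl⟩
    obtain ⟨h1, h2⟩ := of_decide_eq_true (List.mem_filter.1 hw).2
    refine ⟨h1, fun v hv => ?_⟩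
    by_cases hvm : v < m
    · exact h2 v (List.mem_range.2 hvm) fun h => hv (Condition.mem_vars.2 h)
    · simp [valuation, hlen w hw, hvm]

theorem coe_flatMap_eq_sum {α β : Type*} (l : List α) (f : α → List β) :
    ((l.flatMap f : List β) : Multiset β) = (l.map fun a => (f a : Multiset β)).sum := by
  induction l with
  | nil => rfl
  | cons a l ih => rw [List.flatMap_cons, ← Multiset.coe_add, ih, List.map_cons, List.sum_cons]

theorem bagList_eq_groupBag {q : RawQuery I k} (hq : q.IsQuery) {F : List I} (hF : F.Nodup)
    (h0 : default ∈ F) {m : ℕ} (hm : q.varBound ≤ m) (hC : ∀ c ∈ q.consts, c ∈ F)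
    {D : List (ℕ × List I)} (hD : ∀ c ∈ (listDatabase D).carrier, c ∈ F) (d : List I) :
    (bagList F m D q d : Multiset (Fin k → I)) = q.groupBag (listDatabase D) d := by
  classical
  rw [bagList, coe_flatMap_eq_sum, RawQuery.groupBag]
  refine congrArg List.sum (List.map_congr_left fun A hA => ?_)
  rw [Finset.filter_val, satFinset_val_eq (hq A hA).1 hF h0
    (fun v hv => (q.lt_varBound hA hv).trans_le hm) (fun c hc => hC c (q.mem_consts hA hc)) hD,
    Multiset.filter_coe, Multiset.map_coe, List.filter_map, List.map_map]
  congr 2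

theorem mem_of_mem_list_sum {α : Type*} {l : List (Multiset α)} {a : α} (h : a ∈ l.sum) :
    ∃ m ∈ l, a ∈ m := by
  induction l with
  | nil => simp at h
  | cons m l ih =>
    rw [List.sum_cons, Multiset.mem_add] at h
    rcases h with h | h
    · exact ⟨m, List.mem_cons_self, h⟩
    · obtain ⟨m', h1, h2⟩ := ih h
      exact ⟨m', List.mem_cons_of_mem _ h1, h2⟩

theorem mem_groupBag {q : RawQuery I k} (hq : q.IsQuery) {D : Database I} {d : List I}
    {t : Fin k → I} (ht : t ∈ q.groupBag D d) :
    ∃ A ∈ q.disjuncts, ∃ γ ∈ A.satisfying D, q.groupVars.map γ = d ∧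
      t = fun i => γ (q.aggVars i) := by
  obtain ⟨m, hm, ht⟩ := mem_of_mem_list_sum ht
  obtain ⟨A, hA, rfl⟩ := List.mem_map.1 hm
  obtain ⟨γ, hγ, rfl⟩ := Multiset.mem_map.1 ht
  obtain ⟨h1, h2⟩ := Finset.mem_filter.1 hγ
  exact ⟨A, hA, γ, (Condition.mem_satFinset (hq A hA).1).1 h1, h2, rfl⟩

end EvaluationCorrect

/-! ### Changing the database along a monotone map -/

section Transport

variable {I : Type} {k : ℕ} [LinearOrder I]

omit [LinearOrder I] in
theorem list_map_injOn {φ : I → I} {T : Set I} (hφ : Set.InjOn φ T) {u w : List I}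
    (hu : ∀ c ∈ u, c ∈ T) (hw : ∀ c ∈ w, c ∈ T) (h : u.map φ = w.map φ) : u = w := by
  induction u generalizing w with
  | nil => simpa using h.symm
  | cons a u ih =>
    cases w with
    | nil => simp at h
    | cons b w =>
      simp only [List.map_cons, List.cons.injEq, List.mem_cons, forall_eq_or_imp] at *
      exact ⟨hφ hu.1 hw.1 h.1, ih hu.2 hw.2 h.2⟩

theorem CompOp.holds_map_iff {φ : I → I} {T : Set I} (hφ : StrictMonoOn φ T) (o : CompOp)
    {a b : I} (ha : a ∈ T) (hb : b ∈ T) : o.holds (φ a) (φ b) ↔ o.holds a b := by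
  cases o
  · exact hφ.lt_iff_lt ha hb
  · exact hφ.le_iff_le ha hb
  · exact hφ.lt_iff_lt hb ha
  · exact hφ.le_iff_le hb ha
  · exact hφ.injOn.eq_iff ha hb
  · exact not_congr (hφ.injOn.eq_iff ha hb)

/-- The map `φ` carries the part of the database `D` that a query can see to the database `E`: it
is strictly monotone on a set containing the carrier of `D` and the constants `C`, fixes these
constants, and a tuple of elements of this set is in a relation with a name and arity in `S`
if and only if its image is. -/
structure Transports (φ : I → I) (T : Set I) (C : List I) (S : List (ℕ × ℕ)) (D E : Database I) :
    Prop where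
  strictMonoOn : StrictMonoOn φ T
  carrier_subset : ∀ c ∈ D.carrier, c ∈ T
  carrier_image : ∀ c ∈ E.carrier, ∃ t ∈ T, φ t = c
  const_mem : ∀ c ∈ C, c ∈ T
  map_const : ∀ c ∈ C, φ c = c
  mem_iff : ∀ p w, (p, w.length) ∈ S → (∀ c ∈ w, c ∈ T) →
    ((⟨p, w.map φ⟩ : GroundAtom I) ∈ E ↔ (⟨p, w⟩ : GroundAtom I) ∈ D)

namespace Transports

variable {φ : I → I} {T : Set I} {C : List I} {S : List (ℕ × ℕ)} {D E : Database I}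

theorem eval_map (h : Transports φ T C S D E) {A : Condition I}
    (hC : ∀ c, Term.const c ∈ A.flatMap Literal.terms → c ∈ C) {γ γ' : ℕ → I}
    (hγ : ∀ v ∈ A.vars, γ v ∈ T) (hγ' : ∀ v ∈ A.vars, γ' v = φ (γ v)) {t : Term I}
    (ht : t ∈ A.flatMap Literal.terms) : t.eval γ ∈ T ∧ t.eval γ' = φ (t.eval γ) := by
  cases t with
  | var v => exact ⟨hγ v (Condition.mem_vars.2 ht), hγ' v (Condition.mem_vars.2 ht)⟩
  | const c => exact ⟨h.const_mem c (hC c ht), (h.map_const c (hC c ht)).symm⟩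

/-- Comparisons depend only on the order and equality of values in `T`. Relational atoms use
`mem_iff`, an equivalence, so that negated atoms are preserved as well. -/
theorem holds_iff (h : Transports φ T C S D E) {A : Condition I}
    (hC : ∀ c, Term.const c ∈ A.flatMap Literal.terms → c ∈ C)
    (hS : ∀ l ∈ A, ∀ p, l.signature? = some p → p ∈ S) {γ γ' : ℕ → I}
    (hγ : ∀ v ∈ A.vars, γ v ∈ T) (hγ' : ∀ v ∈ A.vars, γ' v = φ (γ v)) {l : Literal I}
    (hl : l ∈ A) : l.Holds E γ' ↔ l.Holds D γ := by
  have ht : ∀ t ∈ l.terms, t.eval γ ∈ T ∧ t.eval γ' = φ (t.eval γ) := fun t ht =>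
    h.eval_map hC hγ hγ' (List.mem_flatMap.2 ⟨l, hl, ht⟩)
  have ha (a : Atom I) (ht : ∀ t ∈ a.args, t.eval γ ∈ T ∧ t.eval γ' = φ (t.eval γ))
      (hp : (a.pred, a.args.length) ∈ S) : a.inst γ' ∈ E ↔ a.inst γ ∈ D := by
    have e : a.args.map (Term.eval γ') = (a.args.map (Term.eval γ)).map φ := by
      rw [List.map_map]
      exact List.map_congr_left fun t h => (ht t h).2
    rw [Atom.inst, e]
    refine h.mem_iff _ _ (by simpa using hp) fun c hc => ?_
    obtain ⟨t, h1, rfl⟩ := List.mem_map.1 hc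
    exact (ht t h1).1
  cases l with
  | pos a => exact ha a ht (hS _ hl _ rfl)
  | neg a => exact not_congr (ha a ht (hS _ hl _ rfl))
  | cmp c =>
    obtain ⟨h1, h2⟩ := ht c.lhs (by simp [Literal.terms])
    obtain ⟨h3, h4⟩ := ht c.rhs (by simp [Literal.terms])
    simp only [Literal.Holds]
    rw [h2, h4]
    exact CompOp.holds_map_iff h.strictMonoOn _ h1 h3

variable [Inhabited I]

open Classical in
/-- The image of an assignment for a condition. -/
noncomputable def pushAssignment (φ : I → I) (A : Condition I) (γ : ℕ → I) (v : ℕ) : I :=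
  if v ∈ A.vars then φ (γ v) else default

theorem mem_of_satisfying (h : Transports φ T C S D E) {A : Condition I} (hA : A.Safe)
    (hC : ∀ c, Term.const c ∈ A.flatMap Literal.terms → c ∈ C) {γ : ℕ → I}
    (hγ : γ ∈ A.satisfying D) {v : ℕ} (hv : v ∈ A.vars) : γ v ∈ T := by
  rcases Condition.limited_value hγ.1 (hA v hv) with h1 | h1
  · exact h.carrier_subset _ h1
  · exact h.const_mem _ (hC _ h1)

/-- An assignment over `E` can be pulled back: its values are constants, which `φ` fixes, or lie in
the carrier of `E`, which is contained in `φ(T)`. The pulled-back assignment satisfies `A` over `D`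
by `holds_iff`. -/
theorem satFinset_eq_image [DecidableEq (ℕ → I)] (h : Transports φ T C S D E) {A : Condition I}
    (hA : A.Safe) (hC : ∀ c, Term.const c ∈ A.flatMap Literal.terms → c ∈ C)
    (hS : ∀ l ∈ A, ∀ p, l.signature? = some p → p ∈ S) :
    A.satFinset E = (A.satFinset D).image (pushAssignment φ A) := by
  ext γ'
  rw [Finset.mem_image, Condition.mem_satFinset hA]
  constructor
  · intro hγ'
    have hex : ∀ v ∈ A.vars, ∃ t ∈ T, φ t = γ' v := by
      intro v hv
      rcases Condition.limited_value hγ'.1 (hA v hv) with h1 | h1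
      · exact h.carrier_image _ h1
      · exact ⟨_, h.const_mem _ (hC _ h1), h.map_const _ (hC _ h1)⟩
    choose! g hg hg' using hex
    classical
    let γ : ℕ → I := fun v => if v ∈ A.vars then g v else default
    have hγ : ∀ v ∈ A.vars, γ v = g v := fun v hv => if_pos hv
    refine ⟨γ, (Condition.mem_satFinset hA).2 ⟨fun l hl => ?_, fun v hv => if_neg hv⟩, ?_⟩
    · refine (h.holds_iff hC hS (fun v hv => ?_) (fun v hv => ?_) hl).1 (hγ'.1 l hl)
      · rw [hγ v hv]; exact hg v hv
      · rw [hγ v hv, hg' v hv]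
    · funext v
      by_cases hv : v ∈ A.vars
      · rw [pushAssignment, if_pos hv, hγ v hv, hg' v hv]
      · rw [pushAssignment, if_neg hv, hγ'.2 v hv]
  · rintro ⟨γ, hγ, rfl⟩
    rw [Condition.mem_satFinset hA] at hγ
    refine ⟨fun l hl => ?_, fun v hv => if_neg hv⟩
    exact (h.holds_iff hC hS (fun v hv => h.mem_of_satisfying hA hC hγ hv)
      (fun v hv => if_pos hv) hl).2 (hγ.1 l hl)

theorem pushAssignment_injOn (h : Transports φ T C S D E) {A : Condition I} (hA : A.Safe)
    (hC : ∀ c, Term.const c ∈ A.flatMap Literal.terms → c ∈ C) :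
    Set.InjOn (pushAssignment φ A) (A.satisfying D) := by
  intro γ hγ γ' hγ' e
  funext v
  by_cases hv : v ∈ A.vars
  · have := congrFun e v
    simp only [pushAssignment, if_pos hv] at this
    exact h.strictMonoOn.injOn (h.mem_of_satisfying hA hC hγ hv)
      (h.mem_of_satisfying hA hC hγ' hv) this
  · rw [hγ.2 v hv, hγ'.2 v hv]

/-- Injectivity of `φ` on `T` is used twice: distinct assignments stay distinct, so multiplicities
are kept, and distinct groups are not merged. -/
theorem groupBag_map (h : Transports φ T C S D E) {q : RawQuery I k} (hq : q.IsQuery)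
    (hC : ∀ c ∈ q.consts, c ∈ C) (hS : ∀ p ∈ q.signature, p ∈ S) {d : List I}
    (hd : ∀ c ∈ d, c ∈ T) :
    q.groupBag E (d.map φ) = (q.groupBag D d).map fun t i => φ (t i) := by
  classical
  rw [RawQuery.groupBag, RawQuery.groupBag]
  refine Eq.trans ?_ (map_list_sum (Multiset.mapAddMonoidHom
    fun (t : Fin k → I) i => φ (t i)) _).symm
  rw [List.map_map]
  refine congrArg List.sum (List.map_congr_left fun A hA => ?_)
  have hAC : ∀ c, Term.const c ∈ A.flatMap Literal.terms → c ∈ C := fun c hc =>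
    hC c (q.mem_consts hA hc)
  have hAS : ∀ l ∈ A, ∀ p, l.signature? = some p → p ∈ S := fun l hl p hp =>
    hS p (q.mem_signature hA hl hp)
  obtain ⟨hA1, hA2, hA3⟩ := hq A hA
  have hset : (A.satFinset E).filter (fun γ => q.groupVars.map γ = d.map φ) =
      ((A.satFinset D).filter fun γ => q.groupVars.map γ = d).image (pushAssignment φ A) := by
    rw [h.satFinset_eq_image hA1 hAC hAS, Finset.filter_image]
    refine congrArg _ (Finset.filter_congr fun γ hγ => ?_)
    rw [Condition.mem_satFinset hA1] at hγ
    have e : q.groupVars.map (pushAssignment φ A γ) = (q.groupVars.map γ).map φ := by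
      rw [List.map_map]
      exact List.map_congr_left fun v hv => if_pos (hA2 v hv)
    rw [e]
    refine ⟨fun heq => ?_, fun heq => by rw [heq]⟩
    refine list_map_injOn h.strictMonoOn.injOn (fun c hc => ?_) hd heq
    obtain ⟨v, hv, rfl⟩ := List.mem_map.1 hc
    exact h.mem_of_satisfying hA1 hAC hγ (hA2 v hv)
  rw [hset, Finset.image_val_of_injOn, Multiset.map_map]
  · simp only [Function.comp, Multiset.coe_mapAddMonoidHom, Multiset.map_map]
    refine Multiset.map_congr rfl fun γ _ => ?_
    funext i
    exact if_pos (hA3 i)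
  · exact (h.pushAssignment_injOn hA1 hAC).mono fun γ hγ =>
      (Condition.mem_satFinset hA1).1 (Finset.mem_filter.1 hγ).1

end Transports

end Transport


/-! ### Reduction to finitely many databases -/

section Reduction

variable {I V : Type} {k : ℕ} [LinearOrder I] [Inhabited I]

/-- A system of finite sets `A s`, one for each element `s` of `T`, that lie in the order of
their indices; each of them is either `{s}` or has at least four elements. -/
structure IsBlockSystem (T : Finset I) (A : I → Finset I) : Prop where
  eq_or_four_le : ∀ s ∈ T, A s = {s} ∨ 4 ≤ (A s).card
  lt : ∀ s ∈ T, ∀ t ∈ T, s < t → ∀ x ∈ A s, ∀ y ∈ A t, x < y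

omit [Inhabited I] in
theorem IsBlockSystem.nonempty {T : Finset I} {A : I → Finset I} (h : IsBlockSystem T A) {s : I}
    (hs : s ∈ T) : (A s).Nonempty := by
  rcases h.eq_or_four_le s hs with h | h
  · simp [h]
  · exact Finset.card_pos.1 (by omega)

omit [Inhabited I] in
theorem IsBlockSystem.strictMonoOn {T : Finset I} {A : I → Finset I} (h : IsBlockSystem T A)
    {φ : I → I} (hφ : ∀ s ∈ T, φ s ∈ A s) : StrictMonoOn φ T := fun s hs t ht hst =>
  h.lt s hs t ht hst _ (hφ s hs) _ (hφ t ht)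

/-- The aggregation function distinguishes different values also after the elements have been
moved into the sets of a block system, for a suitable choice of the new elements. -/
def Separates (α : Multiset (Fin k → I) → V) : Prop :=
  ∀ (T : Finset I) (A : I → Finset I), IsBlockSystem T A →
    ∀ B B' : Multiset (Fin k → I), B ≠ 0 → B' ≠ 0 → (∀ t ∈ B, ∀ i, t i ∈ T) →
      (∀ t ∈ B', ∀ i, t i ∈ T) → α B ≠ α B' →
        ∃ φ : I → I, (∀ s ∈ T, φ s ∈ A s) ∧
          α (B.map fun t i => φ (t i)) ≠ α (B'.map fun t i => φ (t i))

/-- The finite list `F` contains the constants `C`, and every set of at most `N` elements can be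
spread out within `F` without moving the constants. -/
structure IsGrid (C : List I) (N : ℕ) (F : List I) : Prop where
  nodup : F.Nodup
  default_mem : default ∈ F
  subset : ∀ c ∈ C, c ∈ F
  exists_blocks : ∀ S : Finset I, S.card ≤ N → ∃ A : I → Finset I,
    IsBlockSystem (S ∪ C.toFinset) A ∧ (∀ c ∈ C, A c = {c}) ∧
      ∀ s ∈ S ∪ C.toFinset, ∀ x ∈ A s, x ∈ F

/-- A result contains at most one value for each group, so results can be compared group by group.
-/
theorem result_eq_iff {α : Multiset (Fin k → I) → V} {q q' : RawQuery I k} {D : Database I} :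
    q.result α D = q'.result α D ↔
      ∀ d, (q.groupBag D d = 0 ↔ q'.groupBag D d = 0) ∧
        (q.groupBag D d ≠ 0 → α (q.groupBag D d) = α (q'.groupBag D d)) := by
  simp only [RawQuery.result, Set.ext_iff, Prod.forall, Set.mem_ofPred_eq]
  refine forall_congr' fun d => ⟨fun h => ?_, fun ⟨h1, h2⟩ v => ?_⟩
  · by_cases h0 : q.groupBag D d = 0
    · have := h (α (q'.groupBag D d))
      simp only [h0] at this ⊢
      tauto
    · have := (h (α (q.groupBag D d))).1 ⟨h0, rfl⟩
      tauto
  · by_cases h0 : q.groupBag D d = 0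
    · have := h1.1 h0
      tauto
    · have := h2 h0
      rw [this]
      tauto

/-- The bags that two queries collect for a group show that their results differ. -/
def BagsDiffer (α : Multiset (Fin k → I) → V) (B B' : Multiset (Fin k → I)) : Prop :=
  ¬ ((B = 0 ↔ B' = 0) ∧ (B ≠ 0 → α B = α B'))

theorem length_of_mem_groupBag {q : RawQuery I k} (hq : q.IsQuery) {D : Database I} {d : List I}
    (h : q.groupBag D d ≠ 0) : d.length = q.groupVars.length := by
  obtain ⟨t, ht⟩ := Multiset.exists_mem_of_ne_zero h
  obtain ⟨A, _, γ, _, rfl, _⟩ := mem_groupBag hq ht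
  simp

theorem group_mem {q : RawQuery I k} (hq : q.IsQuery) {D : Database I} {d : List I}
    (h : q.groupBag D d ≠ 0) {c : I} (hc : c ∈ d) : c ∈ D.carrier ∨ c ∈ q.consts := by
  obtain ⟨t, ht⟩ := Multiset.exists_mem_of_ne_zero h
  obtain ⟨A, hA, γ, hγ, rfl, _⟩ := mem_groupBag hq ht
  obtain ⟨v, hv, rfl⟩ := List.mem_map.1 hc
  exact (Condition.limited_value hγ.1 ((hq A hA).1 v ((hq A hA).2.1 v hv))).imp_right
    (q.mem_consts hA)

theorem value_mem {q : RawQuery I k} (hq : q.IsQuery) {D : Database I} {d : List I}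
    {t : Fin k → I} (ht : t ∈ q.groupBag D d) (i : Fin k) :
    t i ∈ D.carrier ∨ t i ∈ q.consts := by
  obtain ⟨A, hA, γ, hγ, _, rfl⟩ := mem_groupBag hq ht
  exact (Condition.limited_value hγ.1 ((hq A hA).1 _ ((hq A hA).2.2 i))).imp_right
    (q.mem_consts hA)

omit [Inhabited I] in
theorem mem_carrier {D : Database I} {c : I} : c ∈ D.carrier ↔ ∃ a ∈ D, c ∈ a.args := by
  simp [Database.carrier]

omit [Inhabited I] in
theorem carrier_of_mem_databaseLists {F : List I} {N : ℕ} {S : List (ℕ × ℕ)}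
    {D : List (ℕ × List I)} (hD : D ∈ databaseLists F N S) :
    (listDatabase D).carrier.card ≤ N ∧ ∀ c ∈ (listDatabase D).carrier, c ∈ F := by
  obtain ⟨W, hW, hD⟩ := List.mem_flatMap.1 hD
  obtain ⟨hN, hWF⟩ := mem_listsOfLength.1 hW
  have hsub : (listDatabase D).carrier ⊆ W.toFinset := by
    intro c hc
    obtain ⟨a, ha, hc⟩ := mem_carrier.1 hc
    obtain ⟨p, _, hp⟩ := List.mem_flatMap.1 ((mem_allSublists.1 hD).subset (mem_listDatabase.1 ha))
    obtain ⟨w, hw, e⟩ := List.mem_map.1 hp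
    rw [← (Prod.mk.inj e).2] at hc
    exact List.mem_toFinset.2 ((mem_listsOfLength.1 hw).2 c hc)
  exact ⟨(Finset.card_le_card hsub).trans ((List.toFinset_card_le W).trans hN.le),
    fun c hc => hWF c (List.mem_toFinset.1 (hsub hc))⟩

/-- The image of a database under a strictly monotone map into `F`, restricted to the given
predicates, occurs among the listed databases. -/
theorem exists_transports {φ : I → I} {T : Set I} (hφ : StrictMonoOn φ T) {C : List I}
    (hCT : ∀ c ∈ C, c ∈ T) (hC : ∀ c ∈ C, φ c = c) {D : Database I} (hD : ∀ c ∈ D.carrier, c ∈ T)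
    {F : List I} (h0 : default ∈ F) (hF : ∀ s ∈ T, φ s ∈ F) {N : ℕ} (hN : D.carrier.card ≤ N)
    (S : List (ℕ × ℕ)) :
    ∃ E ∈ databaseLists F N S, Transports φ T C S D (listDatabase E) := by
  classical
  -- `databaseLists` enumerates candidate carriers as lists of length exactly `N`; the padding
  -- attains this length.
  let W : List I := D.carrier.toList.map φ ++ List.replicate (N - D.carrier.card) default
  let L : List (ℕ × List I) := S.flatMap fun p => (listsOfLength W p.2).map fun w => (p.1, w)
  let E : List (ℕ × List I) := L.filter fun p => ∃ a ∈ D, (a.pred, a.args.map φ) = p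
  have hW : W ∈ listsOfLength F N := by
    refine mem_listsOfLength.2 ⟨by simp [W]; omega, fun a ha => ?_⟩
    rcases List.mem_append.1 ha with h | h
    · obtain ⟨c, hc, rfl⟩ := List.mem_map.1 h
      exact hF c (hD c (Finset.mem_toList.1 hc))
    · rw [List.eq_of_mem_replicate h]
      exact h0
  have hargs : ∀ a ∈ D, ∀ c ∈ a.args, c ∈ D.carrier := fun a ha c hc => mem_carrier.2 ⟨a, ha, hc⟩
  refine ⟨E, List.mem_flatMap.2 ⟨W, hW, mem_allSublists.2 List.filter_sublist⟩,
    ⟨hφ, hD, fun c hc => ?_, hCT, hC, fun p w hp hw => ?_⟩⟩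
  · obtain ⟨a, ha, hc⟩ := mem_carrier.1 hc
    obtain ⟨b, hb, e⟩ := of_decide_eq_true (List.mem_filter.1 (mem_listDatabase.1 ha)).2
    rw [← (Prod.mk.inj e).2] at hc
    obtain ⟨t, ht, rfl⟩ := List.mem_map.1 hc
    exact ⟨t, hD t (hargs b hb t ht), rfl⟩
  · rw [mem_listDatabase]
    constructor
    · intro h
      obtain ⟨⟨p', w'⟩, hb, e⟩ := of_decide_eq_true (List.mem_filter.1 h).2
      obtain ⟨rfl, e2⟩ := Prod.mk.inj e
      -- Since `φ` is injective on `T`, the image atom can only come from the atom with arguments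
      -- `w`.
      have : w' = w := list_map_injOn hφ.injOn (fun c hc => hD c (hargs _ hb c hc)) hw e2
      rwa [← this]
    · intro h
      refine List.mem_filter.2 ⟨List.mem_flatMap.2 ⟨_, hp, List.mem_map.2 ⟨w.map φ, ?_, rfl⟩⟩,
        decide_eq_true ⟨_, h, rfl⟩⟩
      refine mem_listsOfLength.2 ⟨by simp, fun a ha => ?_⟩
      obtain ⟨c, hc, rfl⟩ := List.mem_map.1 ha
      exact List.mem_append_left _ (List.mem_map_of_mem (Finset.mem_toList.2 (hargs _ h c hc)))

omit [Inhabited I] in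
-- If exactly one bag is empty, this persists under every map, and any choice from the blocks will
-- do; otherwise the values of `α` differ and `Separates` applies.
theorem Separates.exists_bagsDiffer {α : Multiset (Fin k → I) → V} (hα : Separates α)
    {T : Finset I} {A : I → Finset I} (hA : IsBlockSystem T A) {B B' : Multiset (Fin k → I)}
    (hB : ∀ t ∈ B, ∀ i, t i ∈ T) (hB' : ∀ t ∈ B', ∀ i, t i ∈ T) (h : BagsDiffer α B B') :
    ∃ φ : I → I, (∀ s ∈ T, φ s ∈ A s) ∧
      BagsDiffer α (B.map fun t i => φ (t i)) (B'.map fun t i => φ (t i)) := by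
  by_cases h0 : B = 0 ↔ B' = 0
  · have h1 : B ≠ 0 ∧ α B ≠ α B' := by
      simp only [BagsDiffer] at h
      tauto
    obtain ⟨φ, h2, h3⟩ := hα T A hA B B' h1.1 (fun e => h1.1 (h0.2 e)) hB hB' h1.2
    exact ⟨φ, h2, fun h4 => h3 (h4.2 (by simpa using h1.1))⟩
  · choose! φ hφ using fun s (hs : s ∈ T) => hA.nonempty hs
    exact ⟨φ, hφ, fun h4 => h0 (by simpa using h4.1)⟩

/-- One direction holds because the listed databases have carriers of at most `N` elements. For the
other, a difference at a database `D` and a group `d` is transported into the grid; `φ` may depend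
on the two bags at hand. -/
theorem nEquivalent_iff_agreeOver {α : Multiset (Fin k → I) → V} (hα : Separates α)
    {q q' : RawQuery I k} (hq : q.IsQuery) (hq' : q'.IsQuery) {N : ℕ} {F : List I}
    (hF : IsGrid (q.consts ++ q'.consts) N F) :
    NEquivalent α N q q' ↔ AgreeOver α F N q q' := by
  have hCq : ∀ c ∈ q.consts, c ∈ F := fun c hc => hF.subset c (List.mem_append_left _ hc)
  have hCq' : ∀ c ∈ q'.consts, c ∈ F := fun c hc => hF.subset c (List.mem_append_right _ hc)
  have bag (D : List (ℕ × List I)) (hD : ∀ c ∈ (listDatabase D).carrier, c ∈ F) (d : List I) :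
      (bagList F (q.varBound + q'.varBound) D q d : Multiset (Fin k → I)) =
        q.groupBag (listDatabase D) d :=
    bagList_eq_groupBag hq hF.nodup hF.default_mem (Nat.le_add_right _ _) hCq hD d
  have bag' (D : List (ℕ × List I)) (hD : ∀ c ∈ (listDatabase D).carrier, c ∈ F) (d : List I) :
      (bagList F (q.varBound + q'.varBound) D q' d : Multiset (Fin k → I)) =
        q'.groupBag (listDatabase D) d :=
    bagList_eq_groupBag hq' hF.nodup hF.default_mem (Nat.le_add_left _ _) hCq' hD d
  constructor
  · intro h D hD d _
    obtain ⟨h1, h2⟩ := carrier_of_mem_databaseLists hD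
    have h3 := result_eq_iff.1 (h _ h1) d
    rw [← bag D h2, ← bag' D h2, ne_eq, Multiset.coe_eq_zero, Multiset.coe_eq_zero] at h3
    exact h3
  · intro h D hD
    rw [result_eq_iff]
    by_contra hne
    obtain ⟨d, hd⟩ := not_forall.1 hne
    set C := q.consts ++ q'.consts with hC
    obtain ⟨A, hA, hAC, hAF⟩ := hF.exists_blocks D.carrier hD
    set T : Finset I := D.carrier ∪ C.toFinset with hT
    have hT1 : ∀ c, c ∈ D.carrier ∨ c ∈ q.consts → c ∈ T := fun c hc => by
      simp only [hT, hC, Finset.mem_union, List.mem_toFinset, List.mem_append]; tauto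
    have hT2 : ∀ c, c ∈ D.carrier ∨ c ∈ q'.consts → c ∈ T := fun c hc => by
      simp only [hT, hC, Finset.mem_union, List.mem_toFinset, List.mem_append]; tauto
    have hCT : ∀ c ∈ C, c ∈ T := fun c hc => Finset.mem_union_right _ (List.mem_toFinset.2 hc)
    obtain ⟨φ, hφ, hdiff⟩ := hα.exists_bagsDiffer hA
      (fun t ht i => hT1 _ (value_mem hq ht i)) (fun t ht i => hT2 _ (value_mem hq' ht i)) hd
    have hφC : ∀ c ∈ C, φ c = c := fun c hc => by
      have := hφ c (hCT c hc)
      rwa [hAC c hc, Finset.mem_singleton] at this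
    obtain ⟨E, hE, htr⟩ := exists_transports (T := (T : Set I)) (hA.strictMonoOn hφ) hCT hφC
      (fun c hc => hT1 c (Or.inl hc)) hF.default_mem (fun s hs => hAF s hs _ (hφ s hs)) hD
      (q.signature ++ q'.signature)
    -- The bags differ, so at least one is nonempty; the query that collects it determines the
    -- length of `d` and forces its entries into `T`.
    have hg : (∀ c ∈ d, c ∈ T) ∧
        (d.length = q.groupVars.length ∨ d.length = q'.groupVars.length) := by
      by_cases h0 : q.groupBag D d = 0
      · have h0' : q'.groupBag D d ≠ 0 := fun h0' => hd (by simp [h0, h0'])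
        exact ⟨fun c hc => hT2 c (group_mem hq' h0' hc), Or.inr (length_of_mem_groupBag hq' h0')⟩
      · exact ⟨fun c hc => hT1 c (group_mem hq h0 hc), Or.inl (length_of_mem_groupBag hq h0)⟩
    have hdF : d.map φ ∈
        listsOfLength F q.groupVars.length ++ listsOfLength F q'.groupVars.length := by
      have h1 : ∀ a ∈ d.map φ, a ∈ F := fun a ha => by
        obtain ⟨c, hc, rfl⟩ := List.mem_map.1 ha
        exact hAF c (hg.1 c hc) _ (hφ c (hg.1 c hc))
      simp only [List.mem_append, mem_listsOfLength, List.length_map]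
      exact hg.2.imp (fun e => ⟨e, h1⟩) fun e => ⟨e, h1⟩
    have h2 := (carrier_of_mem_databaseLists hE).2
    have h3 := h E hE _ hdF
    rw [← Multiset.coe_eq_zero, ← Multiset.coe_eq_zero, ne_eq, ← Multiset.coe_eq_zero, bag E h2,
      bag' E h2,
      htr.groupBag_map hq (fun c hc => List.mem_append_left _ hc)
        (fun p hp => List.mem_append_left _ hp) hg.1,
      htr.groupBag_map hq' (fun c hc => List.mem_append_right _ hc)
        (fun p hp => List.mem_append_right _ hp) hg.1] at h3
    exact hdiff h3

theorem boundedEquivalenceDecidable_of_separates [Primcodable I]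
    (hlt : PrimrecRel ((· < ·) : I → I → Prop)) {F : List I → ℕ → List I} (hF : Primrec₂ F)
    (hgrid : ∀ C N, IsGrid C N (F C N)) {α : Multiset (Fin k → I) → V}
    (hα : PrimrecRel fun l l' : List (Fin k → I) => α l = α l')
    (hsep : Separates α) : BoundedEquivalenceDecidable α := by
  have hC : Primrec fun p : ℕ × RawQuery I k × RawQuery I k =>
      F (p.2.1.consts ++ p.2.2.consts) p.1 :=
    hF.comp (Primrec.list_append.comp (primrec_consts.comp (Primrec.fst.comp Primrec.snd))
      (primrec_consts.comp (Primrec.snd.comp Primrec.snd))) Primrec.fst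
  obtain ⟨_, h⟩ := primrecPred_agreeOver hlt hα hC Primrec.fst (Primrec.fst.comp Primrec.snd)
    (Primrec.snd.comp Primrec.snd)
  refine ⟨_, h.to_comp, fun N q q' _ hq hq' => ?_⟩
  rw [decide_eq_true_iff]
  exact (nEquivalent_iff_agreeOver hsep hq hq' (hgrid _ N)).symm

end Reduction


/-! ### Aggregation functions that commute with monotone maps -/

section OrderInvariant

variable {I V : Type} {k : ℕ} [LinearOrder I]

/-- Every choice of one element from each block is strictly monotone on `T`, so for such `α` an
arbitrary choice separates. -/
theorem separates_of_strictMonoOn {α : Multiset (Fin k → I) → V}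
    (h : ∀ (T : Finset I) (φ : I → I), StrictMonoOn φ T → ∀ B B' : Multiset (Fin k → I),
      (∀ t ∈ B, ∀ i, t i ∈ T) → (∀ t ∈ B', ∀ i, t i ∈ T) →
      α (B.map fun t i => φ (t i)) = α (B'.map fun t i => φ (t i)) → α B = α B') :
    Separates α := by
  intro T A hA B B' _ _ hB hB' hne
  choose! φ hφ using fun s (hs : s ∈ T) => hA.nonempty hs
  exact ⟨φ, hφ, fun e => hne (h T φ (hA.strictMonoOn hφ) B B' hB hB' e)⟩

theorem separates_aggCount : Separates (aggCount I k) :=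
  separates_of_strictMonoOn fun T φ _ B B' _ _ h => by simpa [aggCount] using h

theorem separates_aggPrty : Separates (aggPrty I k) :=
  separates_of_strictMonoOn fun T φ _ B B' _ _ h => by simpa [aggPrty] using h

theorem separates_aggCntd : Separates (aggCntd I k) := by
  classical
  have key (T : Finset I) (φ : I → I) (hφ : StrictMonoOn φ T) (B : Multiset (Fin k → I))
      (hB : ∀ t ∈ B, ∀ i, t i ∈ T) :
      aggCntd I k (B.map fun t i => φ (t i)) = aggCntd I k B := by
    rw [aggCntd, aggCntd, Multiset.toFinset_map, Finset.card_image_of_injOn]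
    intro t ht u hu e
    funext i
    exact hφ.injOn (hB t (Multiset.mem_toFinset.1 ht) i) (hB u (Multiset.mem_toFinset.1 hu) i)
      (congrFun e i)
  exact separates_of_strictMonoOn fun T φ hφ B B' hB hB' h => by
    rwa [key T φ hφ B hB, key T φ hφ B' hB'] at h

theorem coe_le_aggMax {B : Multiset (Fin 1 → I)} {x : I} :
    (x : WithBot I) ≤ aggMax I B ↔ ∃ t ∈ B, x ≤ t 0 := by
  induction B using Multiset.induction_on with
  | empty => simp [aggMax]
  | cons a B ih =>
    have e : aggMax I (a ::ₘ B) = (a 0 : WithBot I) ⊔ aggMax I B := by simp [aggMax]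
    rw [e, le_sup_iff, ih]
    simp

theorem coe_lt_aggMax {B : Multiset (Fin 1 → I)} {x : I} :
    (x : WithBot I) < aggMax I B ↔ ∃ t ∈ B, x < t 0 := by
  induction B using Multiset.induction_on with
  | empty => simp [aggMax]
  | cons a B ih =>
    have e : aggMax I (a ::ₘ B) = (a 0 : WithBot I) ⊔ aggMax I B := by simp [aggMax]
    rw [e, lt_sup_iff, ih]
    simp

theorem aggMax_le_iff {B B' : Multiset (Fin 1 → I)} :
    aggMax I B ≤ aggMax I B' ↔ ∀ t ∈ B, ∃ t' ∈ B', t 0 ≤ t' 0 := by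
  rw [show aggMax I B = (B.map fun t => (t 0 : WithBot I)).sup from rfl, Multiset.sup_le]
  simp only [Multiset.mem_map, forall_exists_index, and_imp, forall_apply_eq_imp_iff₂,
    coe_le_aggMax]

/-- Mutual domination refers only to the order on `I`. It is thus visibly preserved by monotone maps
and decidable by search through lists, without computing in `WithBot I`. -/
theorem aggMax_eq_iff {B B' : Multiset (Fin 1 → I)} :
    aggMax I B = aggMax I B' ↔
      (∀ t ∈ B, ∃ t' ∈ B', t 0 ≤ t' 0) ∧ ∀ t ∈ B', ∃ t' ∈ B, t 0 ≤ t' 0 := by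
  rw [le_antisymm_iff, aggMax_le_iff, aggMax_le_iff]

/-- The second component is the maximum of the elements that lie strictly below some element of the
bag, so it too is compared by mutual domination. -/
theorem aggTop2_eq_iff {B B' : Multiset (Fin 1 → I)} :
    aggTop2 I B = aggTop2 I B' ↔ aggMax I B = aggMax I B' ∧
      (∀ t ∈ B, (∃ u ∈ B, t 0 < u 0) → ∃ t' ∈ B', (∃ u ∈ B', t' 0 < u 0) ∧ t 0 ≤ t' 0) ∧
      ∀ t ∈ B', (∃ u ∈ B', t 0 < u 0) → ∃ t' ∈ B, (∃ u ∈ B, t' 0 < u 0) ∧ t 0 ≤ t' 0 := by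
  rw [aggTop2, aggTop2, Prod.mk.injEq, aggMax_eq_iff (B := B.filter _)]
  simp only [Multiset.mem_filter, coe_lt_aggMax, and_imp, and_assoc]

theorem separates_aggMax : Separates (aggMax I) :=
  separates_of_strictMonoOn fun T φ hφ B B' hB hB' h => by
    rw [aggMax_eq_iff] at h ⊢
    simp only [Multiset.mem_map, exists_exists_and_eq_and, forall_exists_index, and_imp,
      forall_apply_eq_imp_iff₂] at h
    refine ⟨fun t ht => ?_, fun t ht => ?_⟩
    · obtain ⟨t', ht', h1⟩ := h.1 t ht
      exact ⟨t', ht', (hφ.le_iff_le (hB t ht 0) (hB' t' ht' 0)).1 h1⟩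
    · obtain ⟨t', ht', h1⟩ := h.2 t ht
      exact ⟨t', ht', (hφ.le_iff_le (hB' t ht 0) (hB t' ht' 0)).1 h1⟩

theorem separates_aggTop2 : Separates (aggTop2 I) := by
  have key (T : Finset I) (φ : I → I) (hφ : StrictMonoOn φ T) (B B' : Multiset (Fin 1 → I))
      (hB : ∀ t ∈ B, ∀ i, t i ∈ T) (hB' : ∀ t ∈ B', ∀ i, t i ∈ T)
      (h : ∀ t ∈ B, (∃ u ∈ B, φ (t 0) < φ (u 0)) →
        ∃ t' ∈ B', (∃ u ∈ B', φ (t' 0) < φ (u 0)) ∧ φ (t 0) ≤ φ (t' 0)) :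
      ∀ t ∈ B, (∃ u ∈ B, t 0 < u 0) → ∃ t' ∈ B', (∃ u ∈ B', t' 0 < u 0) ∧ t 0 ≤ t' 0 := by
    rintro t ht ⟨u, hu, htu⟩
    obtain ⟨t', ht', ⟨u', hu', h1⟩, h2⟩ := h t ht ⟨u, hu, hφ (hB t ht 0) (hB u hu 0) htu⟩
    exact ⟨t', ht', ⟨u', hu', (hφ.lt_iff_lt (hB' t' ht' 0) (hB' u' hu' 0)).1 h1⟩,
      (hφ.le_iff_le (hB t ht 0) (hB' t' ht' 0)).1 h2⟩
  refine separates_of_strictMonoOn fun T φ hφ B B' hB hB' h => ?_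
  rw [aggTop2_eq_iff, aggMax_eq_iff] at h ⊢
  simp only [Multiset.mem_map, exists_exists_and_eq_and, forall_exists_index, and_imp,
    forall_apply_eq_imp_iff₂] at h
  obtain ⟨⟨h1, h2⟩, h3, h4⟩ := h
  refine ⟨⟨fun t ht => ?_, fun t ht => ?_⟩, key T φ hφ B B' hB hB' ?_, key T φ hφ B' B hB' hB ?_⟩
  · obtain ⟨t', ht', h⟩ := h1 t ht
    exact ⟨t', ht', (hφ.le_iff_le (hB t ht 0) (hB' t' ht' 0)).1 h⟩
  · obtain ⟨t', ht', h⟩ := h2 t ht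
    exact ⟨t', ht', (hφ.le_iff_le (hB' t ht 0) (hB t' ht' 0)).1 h⟩
  · rintro t ht ⟨u, hu, htu⟩
    exact h3 t ht u hu htu
  · rintro t ht ⟨u, hu, htu⟩
    exact h4 t ht u hu htu

end OrderInvariant

/-! ### Aggregation functions given by arithmetic operations -/

section Arithmetic

variable {I V : Type} [LinearOrder I]

/-- Elements of `T` are moved into their blocks one by one, keeping the two values different. If
every candidate for `s` made the values equal, the hypothesis would make them equal already before
the move. The intermediate maps need not be monotone. -/
theorem separates_of_update {k : ℕ} {α : Multiset (Fin k → I) → V}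
    (h : ∀ (B B' : Multiset (Fin k → I)) (φ : I → I) (s : I) (A : Finset I), 4 ≤ A.card →
      (∀ x ∈ A, α (B.map fun t i => Function.update φ s x (t i)) =
        α (B'.map fun t i => Function.update φ s x (t i))) →
      α (B.map fun t i => φ (t i)) = α (B'.map fun t i => φ (t i))) : Separates α := by
  intro T A hA B B' _ _ _ _ hne
  suffices H : ∀ U : Finset I, U ⊆ T → ∃ φ : I → I, (∀ s ∈ U, φ s ∈ A s) ∧
      (∀ s, s ∉ U → φ s = s) ∧
      α (B.map fun t i => φ (t i)) ≠ α (B'.map fun t i => φ (t i)) by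
    obtain ⟨φ, h1, _, h2⟩ := H T subset_rfl
    exact ⟨φ, h1, h2⟩
  intro U
  induction U using Finset.induction_on with
  | empty => exact fun _ => ⟨id, by simp, fun _ _ => rfl, by simpa using hne⟩
  | insert s U hs ih =>
    intro hU
    obtain ⟨φ, h1, h2, h3⟩ := ih ((Finset.subset_insert _ _).trans hU)
    rcases hA.eq_or_four_le s (hU (Finset.mem_insert_self _ _)) with h4 | h4
    -- For a singleton block `{s}` nothing has to be done, since `φ` is still the identity at `s`.
    · refine ⟨φ, fun t ht => ?_, fun t ht => h2 t fun h => ht (Finset.mem_insert_of_mem h), h3⟩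
      rcases Finset.mem_insert.1 ht with rfl | ht
      · rw [h2 t hs, h4]
        exact Finset.mem_singleton_self _
      · exact h1 t ht
    · obtain ⟨x, hx, hne'⟩ : ∃ x ∈ A s, α (B.map fun t i => Function.update φ s x (t i)) ≠
          α (B'.map fun t i => Function.update φ s x (t i)) := by
        by_contra hcon
        push Not at hcon
        exact h3 (h B B' φ s (A s) h4 hcon)
      refine ⟨Function.update φ s x, fun t ht => ?_, fun t ht => ?_, hne'⟩
      · by_cases hts : t = s
        · subst hts
          rwa [Function.update_self]
        · rw [Function.update_of_ne hts]
          exact h1 t (Finset.mem_of_mem_insert_of_ne ht hts)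
      · rw [Finset.mem_insert, not_or] at ht
        rw [Function.update_of_ne ht.1]
        exact h2 t ht.2

/-- Over a domain, two affine functions that agree at two points have equal coefficients, hence also
agree at the old value `φ s`. -/
theorem separates_of_affine {R : Type} [CommRing R] [IsDomain R]
    {α : Multiset (Fin 1 → I) → R} {ι : I → R} (hι : Function.Injective ι)
    (h : ∀ (B : Multiset (Fin 1 → I)) (φ : I → I) (s : I), ∃ a b : R, ∀ x,
      α (B.map fun t i => Function.update φ s x (t i)) = a + b * ι x) : Separates α := by
  refine separates_of_update fun B B' φ s A hA hx => ?_
  obtain ⟨a, b, h1⟩ := h B φ s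
  obtain ⟨a', b', h2⟩ := h B' φ s
  obtain ⟨x, hxA, y, hyA, hxy⟩ := Finset.one_lt_card.1 (show 1 < A.card by omega)
  have ex := hx x hxA
  have ey := hx y hyA
  rw [h1, h2] at ex ey
  have hb : b = b' := by
    have h3 : (b - b') * (ι x - ι y) = 0 := by linear_combination ex - ey
    rcases mul_eq_zero.1 h3 with h3 | h3
    · exact sub_eq_zero.1 h3
    · exact absurd (hι (sub_eq_zero.1 h3)) hxy
  have ha : a = a' := by
    rw [hb] at ex
    exact add_right_cancel ex
  have h3 := (h1 (φ s)).trans ((by rw [ha, hb]) : _ = a' + b' * ι (φ s)) |>.trans (h2 (φ s)).symm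
  simpa only [Function.update_eq_self] using h3

/-- The slope `b` is the multiplicity of `s` in the bag; `a` collects the other summands. -/
theorem sum_map_update {R : Type} [CommRing R] (ι : I → R) (B : Multiset (Fin 1 → I))
    (φ : I → I) (s : I) : ∃ a b : R, ∀ x,
      (B.map fun t => ι (Function.update φ s x (t 0))).sum = a + b * ι x := by
  induction B using Multiset.induction_on with
  | empty => exact ⟨0, 0, by simp⟩
  | cons t B ih =>
    obtain ⟨a, b, h⟩ := ih
    by_cases ht : t 0 = s
    · refine ⟨a, b + 1, fun x => ?_⟩
      rw [Multiset.map_cons, Multiset.sum_cons, h, ht,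
        Function.update_self]
      ring
    · refine ⟨ι (φ (t 0)) + a, b, fun x => ?_⟩
      rw [Multiset.map_cons, Multiset.sum_cons, h,
        Function.update_of_ne ht]
      ring

theorem separates_aggSum [CommRing I] [IsDomain I] : Separates (aggSum I) :=
  separates_of_affine Function.injective_id fun B φ s => by
    simpa only [aggSum, Multiset.map_map, Function.comp_def, id] using sum_map_update id B φ s

theorem separates_aggAvgRat : Separates aggAvgRat :=
  separates_of_affine Function.injective_id fun B φ s => by
    obtain ⟨a, b, h⟩ := sum_map_update (id : ℚ → ℚ) B φ s
    refine ⟨a / B.card, b / B.card, fun x => ?_⟩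
    have := h x
    simp only [id] at this
    simp only [aggAvgRat, Multiset.map_map, Function.comp_def, this, Multiset.card_map, id]
    ring

theorem separates_aggAvgInt : Separates aggAvgInt :=
  separates_of_affine (ι := fun x : ℤ => (x : ℚ)) Int.cast_injective fun B φ s => by
    obtain ⟨a, b, h⟩ := sum_map_update (fun x : ℤ => (x : ℚ)) B φ s
    refine ⟨a / B.card, b / B.card, fun x => ?_⟩
    simp only [aggAvgInt, Multiset.map_map, Function.comp_def, h x, Multiset.card_map]
    ring

theorem prod_map_update [CommRing I] (B : Multiset (Fin 1 → I)) (φ : I → I) (s : I) :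
    ∃ (c : I) (m : ℕ), ∀ x, (B.map fun t => Function.update φ s x (t 0)).prod = c * x ^ m := by
  induction B using Multiset.induction_on with
  | empty => exact ⟨1, 0, by simp⟩
  | cons t B ih =>
    obtain ⟨c, m, h⟩ := ih
    by_cases ht : t 0 = s
    · refine ⟨c, m + 1, fun x => ?_⟩
      rw [Multiset.map_cons, Multiset.prod_cons, h, ht,
        Function.update_self]
      ring
    · refine ⟨φ (t 0) * c, m, fun x => ?_⟩
      rw [Multiset.map_cons, Multiset.prod_cons, h,
        Function.update_of_ne ht]
      ring

variable [CommRing I] [IsStrictOrderedRing I]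

/-- If `m'` exceeded `m`, cross-multiplying the two equations would eliminate the coefficients and
leave `y ^ (m' - m) = x ^ (m' - m)`, which is impossible for different absolute values. -/
theorem exponent_le_of_monomials_eq {c c' x y : I} {m m' : ℕ} (hc : c ≠ 0) (hc' : c' ≠ 0)
    (hx0 : x ≠ 0) (hy0 : y ≠ 0) (hxy : |x| ≠ |y|) (hx : c * x ^ m = c' * x ^ m')
    (hy : c * y ^ m = c' * y ^ m') : m' ≤ m := by
  by_contra hlt
  obtain ⟨d, rfl⟩ := Nat.exists_eq_add_of_lt (not_le.1 hlt)
  have h1 : (c * c' * x ^ m * y ^ m) * y ^ (d + 1) = (c * c' * x ^ m * y ^ m) * x ^ (d + 1) := by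
    rw [show m + d + 1 = m + (d + 1) by ring, pow_add] at hx hy
    linear_combination c * y ^ m * hx - c * x ^ m * hy
  have h2 : y ^ (d + 1) = x ^ (d + 1) :=
    mul_left_cancel₀ (mul_ne_zero (mul_ne_zero (mul_ne_zero hc hc') (pow_ne_zero _ hx0))
      (pow_ne_zero _ hy0)) h1
  have h3 : |y| ^ (d + 1) = |x| ^ (d + 1) := by rw [← abs_pow, ← abs_pow, h2]
  exact hxy ((pow_left_inj₀ (abs_nonneg _) (abs_nonneg _) (Nat.succ_ne_zero d)).1 h3).symm

omit [IsStrictOrderedRing I] in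
-- This is where block size four comes from: once a nonzero `x` is chosen, `y` has to avoid only
-- `0`, `x` and `-x`.
theorem exists_abs_ne (A : Finset I) (hA : 4 ≤ A.card) :
    ∃ x ∈ A, ∃ y ∈ A, x ≠ 0 ∧ y ≠ 0 ∧ |x| ≠ |y| := by
  have h1 : (A \ {0}).Nonempty := by
    refine Finset.card_pos.1 (lt_of_lt_of_le ?_ (Finset.le_card_sdiff _ _))
    rw [Finset.card_singleton]
    omega
  obtain ⟨x, hx⟩ := h1
  have h2 : (A \ {0, x, -x}).Nonempty := by
    refine Finset.card_pos.1 (lt_of_lt_of_le ?_ (Finset.le_card_sdiff _ _))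
    have := Finset.card_le_three (a := (0 : I)) (b := x) (c := -x)
    omega
  obtain ⟨y, hy⟩ := h2
  simp only [Finset.mem_sdiff, Finset.mem_singleton, Finset.mem_insert, not_or] at hx hy
  refine ⟨x, hx.1, y, hy.1, hx.2, hy.2.1, fun h => ?_⟩
  rcases abs_eq_abs.1 h with h | h
  · exact hy.2.2.1 h.symm
  · exact hy.2.2.2 (by rw [h, neg_neg])

theorem separates_aggProd : Separates (aggProd I) := by
  refine separates_of_update fun B B' φ s A hA h => ?_
  simp only [aggProd, Multiset.map_map, Function.comp_def] at h ⊢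
  obtain ⟨c, m, h1⟩ := prod_map_update B φ s
  obtain ⟨c', m', h2⟩ := prod_map_update B' φ s
  obtain ⟨x, hxA, y, hyA, hx0, hy0, hxy⟩ := exists_abs_ne A hA
  have ex := h x hxA
  have ey := h y hyA
  rw [h1, h2] at ex ey
  -- The monomials agree as functions: either both coefficients vanish, or the exponents agree and
  -- then the coefficients do. The identity is needed at `z = φ s`, which may lie outside `A`.
  have key : ∀ z, c * z ^ m = c' * z ^ m' := by
    by_cases hc : c = 0
    · have : c' = 0 := by
        rw [hc, zero_mul] at ex
        exact (mul_eq_zero.1 ex.symm).resolve_right (pow_ne_zero _ hx0)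
      simp [hc, this]
    · have hc' : c' ≠ 0 := by
        rintro rfl
        rw [zero_mul] at ex
        exact (mul_ne_zero hc (pow_ne_zero _ hx0)) ex
      have hm : m = m' := le_antisymm
        (exponent_le_of_monomials_eq hc' hc hx0 hy0 hxy ex.symm ey.symm)
        (exponent_le_of_monomials_eq hc hc' hx0 hy0 hxy ex ey)
      subst hm
      have : c = c' := mul_right_cancel₀ (pow_ne_zero _ hx0) ex
      simp [this]
  have := ((h1 (φ s)).trans (key _)).trans (h2 (φ s)).symm
  simpa only [Function.update_eq_self] using this

end Arithmetic

/-! ### Equality of aggregate values is primitive recursive -/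

section PrimrecAggregates

variable {I : Type} [Primcodable I] {k : ℕ}

theorem primrecRel_eq_of_primrec {β V : Type*} [Primcodable β] [Primcodable V] {f : β → V}
    (hf : Primrec f) : PrimrecRel fun a b => f a = f b :=
  Primrec.eq.comp (hf.comp Primrec.fst) (hf.comp Primrec.snd)

theorem primrec_aggCount : Primrec fun l : List (Fin k → I) => aggCount I k l :=
  Primrec.list_length.of_eq fun _ => rfl

theorem primrec_aggPrty : Primrec fun l : List (Fin k → I) => aggPrty I k l :=
  (Primrec.nat_mod.comp Primrec.list_length (Primrec.const 2)).of_eq fun _ => rfl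

theorem primrec_aggCntd [DecidableEq I] :
    Primrec fun l : List (Fin k → I) => aggCntd I k l :=
  (Primrec.list_length.comp primrec_dedup).of_eq fun _ => rfl

theorem primrec_map_apply_zero :
    Primrec fun l : List (Fin 1 → I) => l.map fun t => t 0 :=
  Primrec.list_map Primrec.id (Primrec.fin_app.comp Primrec.snd (Primrec.const 0))

theorem primrec_aggSum [AddCommMonoid I] (h : Primrec₂ ((· + ·) : I → I → I)) :
    Primrec fun l : List (Fin 1 → I) => aggSum I l :=
  ((primrec_list_sum h).comp primrec_map_apply_zero).of_eq fun _ => rfl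

theorem primrec_aggProd [CommMonoid I] (h : Primrec₂ ((· * ·) : I → I → I)) :
    Primrec fun l : List (Fin 1 → I) => aggProd I l :=
  ((primrec_list_prod h).comp primrec_map_apply_zero).of_eq fun _ => rfl

theorem primrec_rat_div_nat : Primrec₂ fun (x : ℚ) (n : ℕ) => x / n := by
  refine (primrec_divNat.comp (primrec_rat_num.comp Primrec.fst) (Primrec.nat_mul.comp
    (primrec_rat_den.comp Primrec.fst) Primrec.snd)).of_eq fun p => ?_
  rw [Nat.cast_mul, ← div_div, Rat.num_div_den]

theorem primrec_aggAvgRat : Primrec fun l : List (Fin 1 → ℚ) => aggAvgRat l :=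
  (primrec_rat_div_nat.comp ((primrec_list_sum primrec_rat_add).comp primrec_map_apply_zero)
    Primrec.list_length).of_eq fun _ => rfl

theorem primrec_aggAvgInt : Primrec fun l : List (Fin 1 → ℤ) => aggAvgInt l := by
  have hc : Primrec fun z : ℤ => (z : ℚ) :=
    (primrec_divNat.comp Primrec.id (Primrec.const 1)).of_eq fun z => by simp
  exact (primrec_rat_div_nat.comp ((primrec_list_sum primrec_rat_add).comp
    (Primrec.list_map (g := fun _ (t : Fin 1 → ℤ) => (t 0 : ℚ)) Primrec.id
      (hc.comp (Primrec.fin_app.comp Primrec.snd (Primrec.const 0)))))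
    Primrec.list_length).of_eq fun _ => rfl

variable [LinearOrder I]

theorem primrecPred_zero_lt (hlt : PrimrecRel ((· < ·) : I → I → Prop)) {β : Type*} [Primcodable β]
    {s t : β → Fin 1 → I} (hs : Primrec s) (ht : Primrec t) : PrimrecPred fun b => s b 0 < t b 0 :=
  hlt.comp (Primrec.fin_app.comp hs (Primrec.const 0)) (Primrec.fin_app.comp ht (Primrec.const 0))

theorem primrecPred_zero_le (hlt : PrimrecRel ((· < ·) : I → I → Prop)) {β : Type*} [Primcodable β]
    {s t : β → Fin 1 → I} (hs : Primrec s) (ht : Primrec t) : PrimrecPred fun b => s b 0 ≤ t b 0 :=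
  (primrecPred_zero_lt hlt ht hs).not.of_eq fun _ => not_lt

theorem primrecRel_dominated (hlt : PrimrecRel ((· < ·) : I → I → Prop)) :
    PrimrecRel fun l l' : List (Fin 1 → I) => ∀ t ∈ l, ∃ t' ∈ l', t 0 ≤ t' 0 :=
  primrecPred_forall_mem Primrec.fst (primrecPred_exists_mem (Primrec.snd.comp Primrec.fst)
    (primrecPred_zero_le hlt (Primrec.snd.comp Primrec.fst) Primrec.snd).primrecRel).primrecRel

theorem primrecRel_aggMax_eq (hlt : PrimrecRel ((· < ·) : I → I → Prop)) :
    PrimrecRel fun l l' : List (Fin 1 → I) => aggMax I l = aggMax I l' :=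
  ((primrecRel_dominated hlt).and (primrecRel_dominated hlt).swap).of_eq fun p => by
    simp only [aggMax_eq_iff, Multiset.mem_coe]

theorem primrecRel_second_dominated (hlt : PrimrecRel ((· < ·) : I → I → Prop)) :
    PrimrecRel fun l l' : List (Fin 1 → I) =>
      ∀ t ∈ l, (∃ u ∈ l, t 0 < u 0) → ∃ t' ∈ l', (∃ u ∈ l', t' 0 < u 0) ∧ t 0 ≤ t' 0 := by
  have hnm : PrimrecRel fun (l : List (Fin 1 → I)) (t : Fin 1 → I) => ∃ u ∈ l, t 0 < u 0 :=
    primrecPred_exists_mem Primrec.fst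
      (primrecPred_zero_lt hlt (Primrec.snd.comp Primrec.fst) Primrec.snd).primrecRel
  refine primrecPred_forall_mem Primrec.fst (R := fun (p : List (Fin 1 → I) × List (Fin 1 → I)) t =>
    (∃ u ∈ p.1, t 0 < u 0) → ∃ t' ∈ p.2, (∃ u ∈ p.2, t' 0 < u 0) ∧ t 0 ≤ t' 0)
    (primrecPred_imp (hnm.comp (Primrec.fst.comp Primrec.fst) Primrec.snd) ?_)
  refine primrecPred_exists_mem (Primrec.snd.comp Primrec.fst)
    (R := fun (p : (List (Fin 1 → I) × List (Fin 1 → I)) × (Fin 1 → I)) t' =>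
      (∃ u ∈ p.1.2, t' 0 < u 0) ∧ p.2 0 ≤ t' 0)
    (PrimrecPred.and (hnm.comp (Primrec.snd.comp (Primrec.fst.comp Primrec.fst)) Primrec.snd) ?_)
  exact primrecPred_zero_le hlt (Primrec.snd.comp Primrec.fst) Primrec.snd

theorem primrecRel_aggTop2_eq (hlt : PrimrecRel ((· < ·) : I → I → Prop)) :
    PrimrecRel fun l l' : List (Fin 1 → I) => aggTop2 I l = aggTop2 I l' :=
  ((primrecRel_aggMax_eq hlt).and ((primrecRel_second_dominated hlt).and
    (primrecRel_second_dominated hlt).swap)).of_eq fun p => by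
      simp only [aggTop2_eq_iff, Multiset.mem_coe]

end PrimrecAggregates


/-! ### Grids of integers and of rational numbers -/

/-- The integers of absolute value at most `b`. -/
def symmRange (b : ℕ) : List ℤ := (List.range (2 * b + 1)).map fun i : ℕ => (i : ℤ) - b

theorem mem_symmRange {b : ℕ} {z : ℤ} : z ∈ symmRange b ↔ |z| ≤ b := by
  simp only [symmRange, List.mem_map, List.mem_range, abs_le]
  constructor
  · rintro ⟨i, hi, rfl⟩
    omega
  · rintro ⟨h1, h2⟩
    exact ⟨(z + b).toNat, by omega, by omega⟩

theorem nodup_symmRange (b : ℕ) : (symmRange b).Nodup :=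
  List.nodup_range.map fun i j h => by simpa using h

theorem primrec_symmRange : Primrec symmRange := by
  refine Primrec.list_map (Primrec.list_range.comp (Primrec.succ.comp
    (Primrec.nat_mul.comp (Primrec.const 2) Primrec.id))) ?_
  exact primrec_natCast_sub.comp Primrec.snd Primrec.fst

section Rank

variable {I : Type} [LinearOrder I]

/-- The number of elements of `S` below `s`. -/
def rankIn (S : Finset I) (s : I) : ℕ := (S.filter (· < s)).card

theorem rankIn_lt_card {S : Finset I} {s : I} (hs : s ∈ S) : rankIn S s < S.card :=
  Finset.card_lt_card (Finset.filter_ssubset.2 ⟨s, hs, lt_irrefl s⟩)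

theorem rankIn_lt_rankIn {S : Finset I} {s t : I} (hs : s ∈ S) (hst : s < t) :
    rankIn S s < rankIn S t := by
  refine Finset.card_lt_card (Finset.ssubset_iff_of_subset (fun x hx => ?_) |>.2
    ⟨s, Finset.mem_filter.2 ⟨hs, hst⟩, fun h => lt_irrefl s (Finset.mem_filter.1 h).2⟩)
  rw [Finset.mem_filter] at hx ⊢
  exact ⟨hx.1, hx.2.trans hst⟩

end Rank

/-- A bound for the absolute values of the listed integers. -/
def absBound (C : List ℤ) : ℕ := (C.map Int.natAbs).sum

theorem abs_le_absBound {C : List ℤ} {c : ℤ} (hc : c ∈ C) : |c| ≤ absBound C := by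
  have : c.natAbs ≤ absBound C :=
    List.single_le_sum (fun _ _ => Nat.zero_le _) _ (List.mem_map_of_mem hc)
  rw [Int.abs_eq_natAbs]
  exact_mod_cast this

theorem primrec_absBound : Primrec absBound :=
  (primrec_list_sum Primrec.nat_add).comp
    (Primrec.list_map Primrec.id (primrec_natAbs.comp Primrec.snd))

/-- The integer grid for the constants `C` and `N` further elements. -/
def intGrid (C : List ℤ) (N : ℕ) : List ℤ := symmRange (absBound C + 4 * N)

theorem primrec_intGrid : Primrec₂ intGrid :=
  primrec_symmRange.comp (Primrec.nat_add.comp (primrec_absBound.comp Primrec.fst)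
    (Primrec.nat_mul.comp (Primrec.const 4) Primrec.snd))

/-- All constants lie in `[-R, R]`, and every element of that interval keeps its place. An element
outside it moves to four consecutive integers selected by its rank in `S`: upwards from `R + 1`, or
upwards from `-(R + 4 * N)`. Ranks are below `N`, so the upper blocks end by `R + 4 * N` and the
lower ones by `-R - 1`. -/
theorem isGrid_intGrid (C : List ℤ) (N : ℕ) : IsGrid C N (intGrid C N) where
  nodup := nodup_symmRange _
  default_mem := mem_symmRange.2 (by rw [show (default : ℤ) = 0 from rfl, abs_zero]; omega)
  subset c hc := mem_symmRange.2 (by have := abs_le_absBound hc; omega)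
  exists_blocks S hS := by
    set R := absBound C with hR
    let lo : ℤ → ℤ := fun s => if R < s then R + 1 + 4 * rankIn S s
      else -(R + 4 * N) + 4 * rankIn S s
    let A : ℤ → Finset ℤ := fun s => if |s| ≤ R then {s} else Finset.Icc (lo s) (lo s + 3)
    have hmem : ∀ s ∈ S ∪ C.toFinset, ¬ |s| ≤ R → s ∈ S := fun s hs hsR =>
      (Finset.mem_union.1 hs).resolve_right fun h => hsR (abs_le_absBound (List.mem_toFinset.1 h))
    have hA : ∀ s ∈ S ∪ C.toFinset, ∀ x ∈ A s,
        (|s| ≤ R ∧ x = s) ∨ (R < s ∧ R + 1 + 4 * rankIn S s ≤ x ∧ x ≤ R + 4 + 4 * rankIn S s ∧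
          rankIn S s < N ∧ s ∈ S) ∨
        (s < -R ∧ -(R + 4 * N : ℤ) + 4 * rankIn S s ≤ x ∧
          x ≤ -(R + 4 * N : ℤ) + 4 * rankIn S s + 3 ∧ rankIn S s < N ∧ s ∈ S) := by
      intro s hs x hx
      by_cases h : |s| ≤ R
      · left
        simp only [A, if_pos h, Finset.mem_singleton] at hx
        exact ⟨h, hx⟩
      · right
        have hsS := hmem s hs h
        have hr := (rankIn_lt_card hsS).trans_le hS
        simp only [A, if_neg h, Finset.mem_Icc, lo] at hx
        rw [abs_le] at h
        split_ifs at hx with h'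
        · left; refine ⟨h', by omega, by omega, hr, hsS⟩
        · right; refine ⟨by omega, by omega, by omega, hr, hsS⟩
    refine ⟨A, ⟨fun s hs => ?_, fun s hs t ht hst x hx y hy => ?_⟩, fun c hc => ?_,
      fun s hs x hx => ?_⟩
    · by_cases h : |s| ≤ R
      · exact Or.inl (if_pos h)
      · right
        simp only [A, if_neg h, Int.card_Icc]
        omega
    · have h1 := hA s hs x hx
      have h2 := hA t ht y hy
      have h3 : s ∈ S → rankIn S s < rankIn S t := fun h => rankIn_lt_rankIn h hst
      rw [abs_le] at h1 h2
      rcases h1 with ⟨_, _⟩ | ⟨_, _, _, _, h1⟩ | ⟨_, _, _, _, h1⟩ <;>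
      rcases h2 with ⟨_, _⟩ | ⟨_, _, _, _, h2⟩ | ⟨_, _, _, _, h2⟩ <;>
      first
        | (have := h3 h1; omega)
        | omega
    · exact if_pos (abs_le_absBound hc)
    · refine mem_symmRange.2 ?_
      have h1 := hA s hs x hx
      rw [abs_le] at h1 ⊢
      push_cast
      omega

/-- A common denominator of the listed rational numbers. -/
def commonDen (C : List ℚ) : ℕ := (C.map Rat.den).prod

/-- The rational grid for the constants `C` and `N` further elements. -/
def ratGrid (C : List ℚ) (N : ℕ) : List ℚ :=
  (symmRange ((absBound (C.map Rat.num) + 1) * (commonDen C * (4 * N + 1)))).map fun z : ℤ =>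
    (z : ℚ) / (commonDen C * (4 * N + 1) : ℕ)

theorem primrec_commonDen : Primrec commonDen :=
  (primrec_list_prod Primrec.nat_mul).comp
    (Primrec.list_map Primrec.id (primrec_rat_den.comp Primrec.snd))

theorem primrec_ratGrid : Primrec₂ ratGrid := by
  have hL : Primrec fun p : List ℚ × ℕ => commonDen p.1 * (4 * p.2 + 1) :=
    Primrec.nat_mul.comp (primrec_commonDen.comp Primrec.fst)
      (Primrec.succ.comp (Primrec.nat_mul.comp (Primrec.const 4) Primrec.snd))
  refine Primrec.list_map (primrec_symmRange.comp (Primrec.nat_mul.comp (Primrec.succ.comp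
    (primrec_absBound.comp ((Primrec.list_map Primrec.id (primrec_rat_num.comp Primrec.snd).to₂).comp
      Primrec.fst))) hL)) ?_
  exact primrec_divNat.comp Primrec.snd (hL.comp Primrec.fst)

theorem commonDen_pos (C : List ℚ) : 0 < commonDen C :=
  List.prod_pos fun n hn => by
    obtain ⟨c, _, rfl⟩ := List.mem_map.1 hn
    exact c.den_pos

/-- With `commonDen C = c.den * e` the integer is `c.num * e`; the numerator is bounded by the sum
of absolute numerators, and `e` by the common denominator. -/
theorem exists_mul_commonDen {C : List ℚ} {c : ℚ} (hc : c ∈ C) :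
    ∃ a : ℤ, c * commonDen C = a ∧ |a| ≤ absBound (C.map Rat.num) * commonDen C := by
  obtain ⟨e, he⟩ : c.den ∣ commonDen C := List.dvd_prod (List.mem_map_of_mem hc)
  have hn : |c.num| ≤ absBound (C.map Rat.num) := abs_le_absBound (List.mem_map_of_mem hc)
  refine ⟨c.num * e, ?_, ?_⟩
  · have hd : (c.den : ℚ) ≠ 0 := by exact_mod_cast c.den_ne_zero
    rw [he]
    push_cast
    rw [← mul_assoc, Rat.mul_den_eq_num]
  · rw [abs_mul, Nat.abs_cast]
    refine mul_le_mul hn ?_ (by positivity) (by positivity)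
    rw [he]
    exact_mod_cast Nat.le_mul_of_pos_left e c.den_pos

/-- The constants are multiples of `1 / Δ`, hence left endpoints of cells of length `1 / Δ`. Each
cell is divided into `K = 4 * N + 1` steps: the left endpoint is kept for a possible constant, and
the remaining `4 * N` points hold one block of four for each possible rank. An element of `S` goes
to a block in its own cell, with cells far from the constants clamped to a bounded range. -/
theorem isGrid_ratGrid (C : List ℚ) (N : ℕ) : IsGrid C N (ratGrid C N) := by
  set K : ℕ := 4 * N + 1 with hK
  set Δ : ℕ := commonDen C with hΔ
  set R : ℕ := absBound (C.map Rat.num) with hR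
  have hΔ0 : 0 < Δ := commonDen_pos C
  have hK0 : 0 < K := Nat.succ_pos _
  have hL0 : (0 : ℚ) < (Δ * K : ℕ) := by exact_mod_cast Nat.mul_pos hΔ0 hK0
  have hmem : ∀ z : ℤ, |z| ≤ ((R + 1) * (Δ * K) : ℕ) → (z : ℚ) / (Δ * K : ℕ) ∈ ratGrid C N :=
    fun z hz => List.mem_map.2 ⟨z, mem_symmRange.2 hz, rfl⟩
  have hinj : Function.Injective fun z : ℤ => (z : ℚ) / (Δ * K : ℕ) := fun x y h => by
    have := (div_left_inj' hL0.ne').1 h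
    exact_mod_cast this
  -- The clamped cell index. The lower limit lies strictly below the index of every constant. The
  -- upper limit may be the index of a constant, since blocks lie to the right of the left endpoint
  -- of their cell.
  let e : ℚ → ℤ := fun s => max (-((R + 1) * Δ : ℤ)) (min (R * Δ) ⌊s * Δ⌋)
  have he_mono : ∀ {s t : ℚ}, s ≤ t → e s ≤ e t := fun {s t} h =>
    max_le_max le_rfl (min_le_min le_rfl (Int.floor_le_floor
      (mul_le_mul_of_nonneg_right h (Nat.cast_nonneg _))))
  have he_const : ∀ c ∈ C, (e c : ℚ) = c * Δ ∧ |e c| ≤ R * Δ := by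
    intro c hc
    obtain ⟨a, h1, h2⟩ := exists_mul_commonDen hc
    have h3 : e c = a := by
      simp only [e]
      rw [h1, Int.floor_intCast]
      rw [abs_le] at h2
      rw [min_eq_right h2.2, max_eq_right]
      nlinarith [h2.1]
    rw [h3]
    exact ⟨h1.symm, h2⟩
  have hback : ∀ c ∈ C, ((e c * K : ℤ) : ℚ) / (Δ * K : ℕ) = c := by
    intro c hc
    rw [div_eq_iff hL0.ne']
    push_cast
    rw [(he_const c hc).1, mul_assoc]
  -- A constant opens a new cell: everything below it has a smaller index, also after clamping.
  have he_lt : ∀ {s c : ℚ}, c ∈ C → s < c → e s < e c := by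
    intro s c hc hs
    obtain ⟨h1, h2⟩ := he_const c hc
    refine max_lt ?_ (min_lt_of_right_lt ?_)
    · rw [abs_le] at h2
      have : (0 : ℤ) < Δ := by exact_mod_cast hΔ0
      nlinarith [h2.1]
    · rw [Int.floor_lt, h1]
      exact mul_lt_mul_of_pos_right hs (by exact_mod_cast hΔ0)
  have he_bound : ∀ s, -((R + 1) * Δ : ℤ) ≤ e s ∧ e s ≤ R * Δ := fun s =>
    ⟨le_max_left _ _, max_le (by nlinarith [Nat.cast_nonneg (α := ℤ) R, Nat.cast_nonneg (α := ℤ) Δ])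
      (min_le_left _ _)⟩
  refine ⟨(nodup_symmRange _).map hinj, ?_, fun c hc => ?_, fun S hS => ?_⟩
  · have := hmem 0 (by rw [abs_zero]; exact Int.natCast_nonneg _)
    rwa [Int.cast_zero, zero_div] at this
  · obtain ⟨h1, h2⟩ := he_const c hc
    have h3 := hmem (e c * K) (by
      rw [abs_mul, Nat.abs_cast]
      push_cast
      rw [← mul_assoc]
      refine mul_le_mul_of_nonneg_right (h2.trans ?_) (Nat.cast_nonneg _)
      exact mul_le_mul_of_nonneg_right (by omega) (Nat.cast_nonneg _))
    rwa [hback c hc] at h3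
  -- Numerators over the denominator `Δ * K`. The shift by `1` leaves the left endpoint free, and
  -- rank at most `N - 1` keeps the block within the offset `4 * N = K - 1`.
  · let code : ℚ → Finset ℤ := fun s => if s ∈ C then {e s * K} else
      Finset.Icc (e s * K + 4 * rankIn S s + 1) (e s * K + 4 * rankIn S s + 4)
    have hcode : ∀ s ∈ S ∪ C.toFinset, ∀ z ∈ code s, (s ∈ C ∧ z = e s * K) ∨
        (s ∈ S ∧ s ∉ C ∧ e s * K + 4 * rankIn S s + 1 ≤ z ∧ z ≤ e s * K + 4 * rankIn S s + 4 ∧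
          z ≤ e s * K + (K - 1)) := by
      intro s hs z hz
      by_cases h : s ∈ C
      · simp only [code, if_pos h, Finset.mem_singleton] at hz
        exact Or.inl ⟨h, hz⟩
      · have hsS : s ∈ S := (Finset.mem_union.1 hs).resolve_right fun h' =>
          h (List.mem_toFinset.1 h')
        have hr := (rankIn_lt_card hsS).trans_le hS
        simp only [code, if_neg h, Finset.mem_Icc] at hz
        exact Or.inr ⟨hsS, h, hz.1, hz.2, by omega⟩
    have hcode' : ∀ s ∈ S ∪ C.toFinset, ∀ z ∈ code s,
        e s * K ≤ z ∧ z ≤ e s * K + (K - 1) := by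
      intro s hs z hz
      rcases hcode s hs z hz with ⟨_, h⟩ | ⟨_, _, h1, h2, h3⟩ <;> constructor <;> omega
    have hlt : ∀ s ∈ S ∪ C.toFinset, ∀ t ∈ S ∪ C.toFinset, s < t →
        ∀ x ∈ code s, ∀ y ∈ code t, x < y := by
      intro s hs t ht hst x hx y hy
      -- Different cells are disjoint and ordered. Within one cell the larger element `t` is not a
      -- constant, so either `s` is the constant at the left endpoint or the ranks order the blocks.
      rcases (he_mono hst.le).lt_or_eq with h | h
      · have h1 := (hcode' s hs x hx).2
        have h2 := (hcode' t ht y hy).1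
        have h3 : (e s + 1) * K ≤ e t * K :=
          mul_le_mul_of_nonneg_right h (Nat.cast_nonneg _)
        rw [add_mul, one_mul] at h3
        omega
      · rcases hcode t ht y hy with ⟨htC, _⟩ | ⟨_, _, h2, _, _⟩
        · exact absurd h (he_lt htC hst).ne
        · rw [← h] at h2
          rcases hcode s hs x hx with ⟨_, h1⟩ | ⟨hsS, _, _, h1, _⟩
          · omega
          · have := rankIn_lt_rankIn hsS hst
            omega
    refine ⟨fun s => (code s).image fun z : ℤ => (z : ℚ) / (Δ * K : ℕ),
      ⟨fun s hs => ?_, fun s hs t ht hst x hx y hy => ?_⟩, fun c hc => ?_, fun s hs x hx => ?_⟩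
    · by_cases h : s ∈ C
      · left
        simp only [code, if_pos h, Finset.image_singleton]
        rw [hback s h]
      · right
        rw [Finset.card_image_of_injective _ hinj]
        simp only [code, if_neg h, Int.card_Icc]
        omega
    · obtain ⟨z, hz, rfl⟩ := Finset.mem_image.1 hx
      obtain ⟨w, hw, rfl⟩ := Finset.mem_image.1 hy
      exact div_lt_div_of_pos_right (by exact_mod_cast hlt s hs t ht hst z hz w hw) hL0
    · simp only [code, if_pos hc, Finset.image_singleton]
      rw [hback c hc]
    · obtain ⟨z, hz, rfl⟩ := Finset.mem_image.1 hx
      refine hmem z ?_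
      obtain ⟨h1, h2⟩ := hcode' s hs z hz
      obtain ⟨h3, h4⟩ := he_bound s
      have h5 := mul_le_mul_of_nonneg_right h3 (Nat.cast_nonneg (α := ℤ) K)
      have h6 := mul_le_mul_of_nonneg_right h4 (Nat.cast_nonneg (α := ℤ) K)
      have h7 : (1 : ℤ) * K ≤ Δ * K :=
        mul_le_mul_of_nonneg_right (by exact_mod_cast hΔ0) (Nat.cast_nonneg _)
      rw [abs_le]
      push_cast
      constructor <;> nlinarith


/-! ### Decidability over the rational numbers and over the integers. -/

theorem boundedEquivalenceDecidable_rat {V : Type} {k : ℕ} {α : Multiset (Fin k → ℚ) → V}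
    (hsep : Separates α) (hα : PrimrecRel fun l l' : List (Fin k → ℚ) => α l = α l') :
    BoundedEquivalenceDecidable α :=
  boundedEquivalenceDecidable_of_separates primrec_rat_lt primrec_ratGrid isGrid_ratGrid hα hsep

theorem boundedEquivalenceDecidable_int {V : Type} {k : ℕ} {α : Multiset (Fin k → ℤ) → V}
    (hsep : Separates α) (hα : PrimrecRel fun l l' : List (Fin k → ℤ) => α l = α l') :
    BoundedEquivalenceDecidable α :=
  boundedEquivalenceDecidable_of_separates primrec_int_lt primrec_intGrid isGrid_intGrid hα hsep

end AggQuery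

theorem mainTheorem5 :
    (AggQuery.BoundedEquivalenceDecidable (AggQuery.aggMax ℚ) ∧
      AggQuery.BoundedEquivalenceDecidable (AggQuery.aggSum ℚ) ∧
      AggQuery.BoundedEquivalenceDecidable (AggQuery.aggProd ℚ) ∧
      AggQuery.BoundedEquivalenceDecidable AggQuery.aggAvgRat ∧
      (∀ k : ℕ, AggQuery.BoundedEquivalenceDecidable (AggQuery.aggCntd ℚ k)) ∧
      (∀ k : ℕ, AggQuery.BoundedEquivalenceDecidable (AggQuery.aggCount ℚ k)) ∧
      (∀ k : ℕ, AggQuery.BoundedEquivalenceDecidable (AggQuery.aggPrty ℚ k)) ∧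
      AggQuery.BoundedEquivalenceDecidable (AggQuery.aggTop2 ℚ)) ∧
    (AggQuery.BoundedEquivalenceDecidable (AggQuery.aggMax ℤ) ∧
      AggQuery.BoundedEquivalenceDecidable (AggQuery.aggSum ℤ) ∧
      AggQuery.BoundedEquivalenceDecidable (AggQuery.aggProd ℤ) ∧
      AggQuery.BoundedEquivalenceDecidable AggQuery.aggAvgInt ∧
      (∀ k : ℕ, AggQuery.BoundedEquivalenceDecidable (AggQuery.aggCntd ℤ k)) ∧
      (∀ k : ℕ, AggQuery.BoundedEquivalenceDecidable (AggQuery.aggCount ℤ k)) ∧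
      (∀ k : ℕ, AggQuery.BoundedEquivalenceDecidable (AggQuery.aggPrty ℤ k)) ∧
      AggQuery.BoundedEquivalenceDecidable (AggQuery.aggTop2 ℤ)) := by
  refine ⟨⟨?_, ?_, ?_, ?_, fun k => ?_, fun k => ?_, fun k => ?_, ?_⟩,
    ?_, ?_, ?_, ?_, fun k => ?_, fun k => ?_, fun k => ?_, ?_⟩
  · exact AggQuery.boundedEquivalenceDecidable_rat AggQuery.separates_aggMax
      (AggQuery.primrecRel_aggMax_eq AggQuery.primrec_rat_lt)
  · exact AggQuery.boundedEquivalenceDecidable_rat AggQuery.separates_aggSum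
      (AggQuery.primrecRel_eq_of_primrec (AggQuery.primrec_aggSum AggQuery.primrec_rat_add))
  · exact AggQuery.boundedEquivalenceDecidable_rat AggQuery.separates_aggProd
      (AggQuery.primrecRel_eq_of_primrec (AggQuery.primrec_aggProd AggQuery.primrec_rat_mul))
  · exact AggQuery.boundedEquivalenceDecidable_rat AggQuery.separates_aggAvgRat
      (AggQuery.primrecRel_eq_of_primrec AggQuery.primrec_aggAvgRat)
  · exact AggQuery.boundedEquivalenceDecidable_rat AggQuery.separates_aggCntd
      (AggQuery.primrecRel_eq_of_primrec AggQuery.primrec_aggCntd)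
  · exact AggQuery.boundedEquivalenceDecidable_rat AggQuery.separates_aggCount
      (AggQuery.primrecRel_eq_of_primrec AggQuery.primrec_aggCount)
  · exact AggQuery.boundedEquivalenceDecidable_rat AggQuery.separates_aggPrty
      (AggQuery.primrecRel_eq_of_primrec AggQuery.primrec_aggPrty)
  · exact AggQuery.boundedEquivalenceDecidable_rat AggQuery.separates_aggTop2
      (AggQuery.primrecRel_aggTop2_eq AggQuery.primrec_rat_lt)
  · exact AggQuery.boundedEquivalenceDecidable_int AggQuery.separates_aggMax
      (AggQuery.primrecRel_aggMax_eq AggQuery.primrec_int_lt)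
  · exact AggQuery.boundedEquivalenceDecidable_int AggQuery.separates_aggSum
      (AggQuery.primrecRel_eq_of_primrec (AggQuery.primrec_aggSum AggQuery.primrec_int_add))
  · exact AggQuery.boundedEquivalenceDecidable_int AggQuery.separates_aggProd
      (AggQuery.primrecRel_eq_of_primrec (AggQuery.primrec_aggProd AggQuery.primrec_int_mul))
  · exact AggQuery.boundedEquivalenceDecidable_int AggQuery.separates_aggAvgInt
      (AggQuery.primrecRel_eq_of_primrec AggQuery.primrec_aggAvgInt)
  · exact AggQuery.boundedEquivalenceDecidable_int AggQuery.separates_aggCntd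
      (AggQuery.primrecRel_eq_of_primrec AggQuery.primrec_aggCntd)
  · exact AggQuery.boundedEquivalenceDecidable_int AggQuery.separates_aggCount
      (AggQuery.primrecRel_eq_of_primrec AggQuery.primrec_aggCount)
  · exact AggQuery.boundedEquivalenceDecidable_int AggQuery.separates_aggPrty
      (AggQuery.primrecRel_eq_of_primrec AggQuery.primrec_aggPrty)
  · exact AggQuery.boundedEquivalenceDecidable_int AggQuery.separates_aggTop2
      (AggQuery.primrecRel_aggTop2_eq AggQuery.primrec_int_lt)
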